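/- For integers $n,m$ and a probability distribution $P$ on $\{0,1,\dots,m\}$, the active random intersection graph $G_1(n,m,P)$ has vertices $v_1,\dots,v_n$. The vertices independently select random attribute sets $D_1,\dots,D_n\subset W$, where $|W|=m$, with the common law $\mathbf P(D_i=A)=\binom{m}{|A|}^{-1}P(|A|)$ for every $A\subset W$. Distinct vertices $v_i,v_j$ are adjacent, $v_i\sim v_j$, if and only if $D_i\cap D_j\neq\emptyset$. Let $d(u,v)$ be the number of common neighbours of $u$ and $v$, let $(v_1^*,v_2^*)$ be a uniformly random pair of distinct vertices, independent of the graph, and put $$cl(r)=\mathbf P\big(v_1^*\sim v_2^*\,\big|\,d(v_1^*,v_2^*)=r\big),\qquad p_e=\mathbf P(v_1\sim v_2).$$ **Theorem.** Consider a sequence of graphs $G_1(n,m_n,P_n)$, $n\to\infty$, put $\beta_n=m_n/n$, and let $X_n$ be a random variable with law $P_n$. Let $Z$ be a real random variable. Assume that $X_n\sqrt{n/m_n}$ converges in distribution to $Z$, that $\mathbf EZ^2<\infty$ and $\mathbf E\big(X_n\sqrt{n/m_n}\big)^2\to\mathbf EZ^2$, that $\mathbf EZ>0$, and that $\beta_n\to+\infty$.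 Write $z_r=\mathbf EZ^r$ and $\delta_r=\mathbf E d_*^r$, where $d_*$ has the distribution $\mathbf P(d_*=k)=\mathbf E\,e^{-z_1Z}(z_1Z)^k/k!$, $k=0,1,2,\dots$. Then, as $n\to\infty$ (in each statement about $cl(r)$ the conditioning event has positive probability for all sufficiently large $n$): 1. $cl(0)=p_e(1+o(1))$ and $cl(1)=\beta_n^{-1/2}(z_1/z_2)(1+o(1))+O(n^{-1})$. In particular, $cl(0)=O(n^{-1})$ and $cl(1)=o(1)$. 2. $cl(2)=1+o(1)$ if $\beta_n/n\to0$; $\;cl(2)=\dfrac1{1+\beta_*(\delta_2-\delta_1)^4\delta_1^{-6}}+o(1)$ if $\beta_n/n\to\beta_*\in(0,+\infty)$; $\;cl(2)=o(1)$ if $\beta_n/n\to+\infty$. 3. If, in addition, $\beta_n^k=o(n)$ for each $k=1,2,3,\dots$, then $cl(r)=1+o(1)$ for each $r=2,3,\dots$. -/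

import Mathlib

open Filter Topology MeasureTheory ProbabilityTheory Asymptotics

noncomputable section

namespace ActiveGraph

/-- The intersection graph of the attribute sets `D v`: two distinct vertices are adjacent if and
only if their attribute sets share at least one attribute. -/
def intersectionGraph {V W : Type*} (D : V → Finset W) : SimpleGraph V where
  Adj u v := u ≠ v ∧ ¬ Disjoint (D u) (D v)
  symm := ⟨fun _ _ h => ⟨h.1.symm, fun hd => h.2 hd.symm⟩⟩
  loopless := ⟨fun _ h => h.1 rfl⟩

/-- The mass `(m choose |A|)⁻¹ * P(|A|)` which the law of one attribute set gives to `A`. -/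
def attrMass {m : ℕ} (P : PMF (Fin (m + 1))) (A : Finset (Fin m)) : ENNReal :=
  ((m.choose A.card : ℕ) : ENNReal)⁻¹ *
    P ⟨A.card, Nat.lt_succ_of_le (by simpa using A.card_le_univ)⟩

theorem sum_attrMass {m : ℕ} (P : PMF (Fin (m + 1))) : ∑ A, attrMass P A = 1 := by
  let f : ℕ → ENNReal := fun k => ((m.choose k : ℕ) : ENNReal)⁻¹ *
    (if h : k < m + 1 then P ⟨k, h⟩ else 0)
  have h1 : ∀ A : Finset (Fin m), attrMass P A = f A.card := by
    intro A
    have hA : A.card < m + 1 := Nat.lt_succ_of_le (by simpa using A.card_le_univ)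
    simp only [attrMass, f, dif_pos hA]
  rw [Finset.sum_congr rfl fun A _ => h1 A, ← Finset.powerset_univ,
    Finset.sum_powerset_apply_card f, Finset.card_univ, Fintype.card_fin]
  have hP : ∑ k : Fin (m + 1), P k = 1 :=
    (tsum_fintype (L := .unconditional _) P).symm.trans P.tsum_coe
  rw [Finset.sum_range, ← hP]
  refine Finset.sum_congr rfl fun k _ => ?_
  have hk : (k : ℕ) ≤ m := Nat.lt_succ_iff.mp k.2
  have h0 : ((m.choose k : ℕ) : ENNReal) ≠ 0 := by
    exact_mod_cast (Nat.choose_pos hk).ne'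
  simp only [f]
  rw [nsmul_eq_mul, dif_pos k.2, ← mul_assoc,
    ENNReal.mul_inv_cancel h0 (ENNReal.natCast_ne_top _), one_mul]

/-- The law of one random attribute set: `Pr(D = A) = (m choose |A|)⁻¹ * P(|A|)` for every subset
`A` of the set of `m` attributes. -/
def attrLaw {m : ℕ} (P : PMF (Fin (m + 1))) : PMF (Finset (Fin m)) :=
  PMF.ofFintype (attrMass P) (sum_attrMass P)

/-- The law of the independent, identically distributed attribute sets `D_1, …, D_n`. The active
random intersection graph `G_1(n, m, P)` is `intersectionGraph D` for `D` drawn from this law. -/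
def attrMeasure (n : ℕ) {m : ℕ} (P : PMF (Fin (m + 1))) : Measure (Fin n → Finset (Fin m)) :=
  Measure.pi fun _ => (attrLaw P).toMeasure

/-- The joint law of the attribute sets and of an independent random pair `(v₁*, v₂*)` of distinct
vertices, chosen uniformly at random. -/
def jointLaw (n : ℕ) {m : ℕ} (P : PMF (Fin (m + 1))) :
    Measure ((Fin n → Finset (Fin m)) × (Fin n × Fin n)) :=
  (attrMeasure n P).prod (uniformOn {p : Fin n × Fin n | p.1 ≠ p.2})

/-- The event that the random pair of vertices is adjacent. -/
def adjEvent (n m : ℕ) : Set ((Fin n → Finset (Fin m)) × (Fin n × Fin n)) :=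
  {ω | (intersectionGraph ω.1).Adj ω.2.1 ω.2.2}

/-- The event that the random pair of vertices has exactly `r` common neighbours. -/
def commonEvent (n m r : ℕ) : Set ((Fin n → Finset (Fin m)) × (Fin n × Fin n)) :=
  {ω | ((intersectionGraph ω.1).commonNeighbors ω.2.1 ω.2.2).ncard = r}

/-- The clustering function `cl(r) = Pr(v₁* ∼ v₂* | d(v₁*, v₂*) = r)` of `G_1(n, m, P)`. -/
def cl (n : ℕ) {m : ℕ} (P : PMF (Fin (m + 1))) (r : ℕ) : ℝ :=
  ((jointLaw n P)[|commonEvent n m r]).real (adjEvent n m)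

/-- The edge probability `p_e = Pr(v₁ ∼ v₂)` of `G_1(n, m, P)` (for `n ≥ 2`). -/
def edgeProb (n : ℕ) {m : ℕ} (P : PMF (Fin (m + 1))) : ℝ :=
  if h : 2 ≤ n then
    (attrMeasure n P).real {D | (intersectionGraph D).Adj ⟨0, by omega⟩ ⟨1, by omega⟩}
  else 0

/-- The rescaled size `x √(n/m)` of an attribute set of size `x`. -/
def scaledSize (n m : ℕ) (x : Fin (m + 1)) : ℝ := (x : ℝ) * √((n : ℝ) / m)

/-- The moment `z_r = E Z^r`. -/
def zMoment {Ω : Type*} [MeasurableSpace Ω] (μ : Measure Ω) (Z : Ω → ℝ) (r : ℕ) : ℝ :=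
  ∫ ω, Z ω ^ r ∂μ

/-- The asymptotic degree distribution `Pr(d_* = k) = E e^{-z_1 Z} (z_1 Z)^k / k!`. -/
def degreeProb {Ω : Type*} [MeasurableSpace Ω] (μ : Measure Ω) (Z : Ω → ℝ) (k : ℕ) : ℝ :=
  ∫ ω, Real.exp (-(zMoment μ Z 1 * Z ω)) * (zMoment μ Z 1 * Z ω) ^ k / (k.factorial : ℝ) ∂μ

/-- The moment `δ_r = E d_*^r` of the asymptotic degree distribution. -/
def degreeMoment {Ω : Type*} [MeasurableSpace Ω] (μ : Measure Ω) (Z : Ω → ℝ) (r : ℕ) : ℝ :=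
  ∑' k : ℕ, (k : ℝ) ^ r * degreeProb μ Z k

end ActiveGraph

end

noncomputable section

namespace ActiveGraph

/-! Given the attribute sets `A`, `B` of two vertices, each of the other `n - 2` vertices is
independently a common neighbour with probability `q = jointHit P A B`, so the number of common
neighbours is binomial with parameters `n - 2` and `q`. Hence `cl(r)` is the ratio `adjProb /
(adjProb + nonadjProb)` (`cl_eq`), and everything reduces to comparing two expectations over
independent pairs `(A, B)`.

Put `t = √β`, so that `m = t² n`, `E X ≈ z₁ t` and `E X² ≈ z₂ t²`. An adjacent pair occurs with
probability about `z₁² / n` and typically shares one attribute; a third vertex then hits both sets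
mainly by owning that attribute, so `q ≈ E X / m` and `n q ≈ z₁ / t`. A disjoint pair needs two
separate attributes, so `q ≈ |A| |B| E X² / m²`, and `n q` is of order `1 / n`. This suggests
P(adjacent, `d = r`) ≈ `(z₁² / n) (z₁ / t)^r / r!`, and P(not adjacent, `d = r`) ≈ `z₂^r z_r² / (r!
n^r)`. For `r = 0, 1` the second quantity dominates. For `r = 2` the two are `z₁⁴ / (2 t² n)` and
`z₂⁴ / (2 n²)`, so `β / n` decides. For `r ≥ 2`, a lower bound of order `1 / (n t^r)` on the first
and an upper bound of order `1 / n²` on the second suffice when `t^r = o(n)`.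

Only second moments are available, so the heuristics with higher moments are not used as such. The
two-sided bounds on `q` are `jointHit_le`, `le_jointHit_of_not_disjoint` and
`le_jointHit_of_disjoint`. Where a higher moment would appear, sizes are truncated at `K t`; one
lets `n → ∞` first and `K → ∞` afterwards (`tendsto_of_families`). `momentLimits` extracts all
needed limits from convergence in distribution and of second moments. Finally the mixed Poisson law
gives `δ₁ = z₁²` and `δ₂ - δ₁ = z₁² z₂`, which turns `(z₂ / z₁)⁴` into the stated expression. -/

/-- The real-valued mass function of one attribute set. -/
def wt {m : ℕ} (P : PMF (Fin (m + 1))) (A : Finset (Fin m)) : ℝ := (attrLaw P A).toReal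

/-- The expectation of `f D₁ D₂` for two independent attribute sets `D₁`, `D₂`. -/
def pairEx {m : ℕ} (P : PMF (Fin (m + 1))) (f : Finset (Fin m) → Finset (Fin m) → ℝ) : ℝ :=
  ∑ A, ∑ B, wt P A * wt P B * f A B

/-- The probability that a random attribute set meets both `A` and `B`. -/
def jointHit {m : ℕ} (P : PMF (Fin (m + 1))) (A B : Finset (Fin m)) : ℝ :=
  ∑ C, wt P C * if ¬Disjoint A C ∧ ¬Disjoint B C then 1 else 0

/-- The binomial probability `C(N, r) q ^ r (1 - q) ^ (N - r)`. -/
def binMass (N r : ℕ) (q : ℝ) : ℝ := N.choose r * q ^ r * (1 - q) ^ (N - r)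

/-! ### The binomial law of the number of common neighbours, and `cl` as a ratio -/

section

variable {m : ℕ} (P : PMF (Fin (m + 1)))

theorem wt_nonneg (A : Finset (Fin m)) : 0 ≤ wt P A := ENNReal.toReal_nonneg

theorem wt_eq_real (A : Finset (Fin m)) : wt P A = (attrLaw P).toMeasure.real {A} := by
  rw [measureReal_def, PMF.toMeasure_apply_singleton _ _ (measurableSet_singleton A), wt]

theorem toMeasure_attrLaw_real (p : Finset (Fin m) → Prop) [DecidablePred p] :
    (attrLaw P).toMeasure.real {A | p A} = ∑ A, wt P A * if p A then 1 else 0 := by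
  have h := sum_measureReal_singleton (μ := (attrLaw P).toMeasure) (Finset.univ.filter p)
  rw [Finset.coe_filter] at h
  simp only [Finset.mem_univ, true_and] at h
  rw [← h, Finset.sum_filter]
  refine Finset.sum_congr rfl fun A _ => ?_
  rw [← wt_eq_real]
  split_ifs <;> simp

theorem sum_wt : ∑ A, wt P A = 1 := by
  have h := toMeasure_attrLaw_real P (fun _ => True)
  simpa using h.symm

instance instIsProbabilityMeasureAttrMeasure (n : ℕ) : IsProbabilityMeasure (attrMeasure n P) := by
  unfold attrMeasure; infer_instance

/-- The common neighbours of `u` and `v` as a finite set. -/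
def commonFinset {n : ℕ} (u v : Fin n) (D : Fin n → Finset (Fin m)) : Finset (Fin n) :=
  ({u, v}ᶜ : Finset (Fin n)).filter fun i => ¬Disjoint (D u) (D i) ∧ ¬Disjoint (D v) (D i)

theorem ncard_commonNeighbors {n : ℕ} (u v : Fin n) (D : Fin n → Finset (Fin m)) :
    ((intersectionGraph D).commonNeighbors u v).ncard = (commonFinset u v D).card := by
  have : (intersectionGraph D).commonNeighbors u v = (commonFinset u v D : Set (Fin n)) := by
    ext i
    simp only [SimpleGraph.commonNeighbors, Set.mem_inter_iff, SimpleGraph.mem_neighborSet,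
      intersectionGraph, commonFinset, Finset.coe_filter, Finset.mem_compl, Finset.mem_insert,
      Finset.mem_singleton, Set.mem_ofPred_eq, not_or]
    tauto
  rw [this, Set.ncard_coe_finset]

theorem attrMeasure_real_cylinder {n : ℕ} {u v : Fin n} (huv : u ≠ v) (A B : Finset (Fin m))
    (s : Fin n → Set (Finset (Fin m))) :
    (attrMeasure n P).real {D | D u = A ∧ D v = B ∧ ∀ i ∈ ({u, v}ᶜ : Finset (Fin n)), D i ∈ s i} =
      wt P A * wt P B * ∏ i ∈ ({u, v}ᶜ : Finset (Fin n)), (attrLaw P).toMeasure.real (s i) := by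
  let t : Fin n → Set (Finset (Fin m)) := fun i => if i = u then {A} else if i = v then {B} else s i
  have hs : {D : Fin n → Finset (Fin m) | D u = A ∧ D v = B ∧
      ∀ i ∈ ({u, v}ᶜ : Finset (Fin n)), D i ∈ s i} = Set.univ.pi t := by
    ext D
    simp only [Set.mem_ofPred_eq, Set.mem_univ_pi, t, Finset.mem_compl, Finset.mem_insert,
      Finset.mem_singleton, not_or]
    constructor
    · rintro ⟨h1, h2, h3⟩ i
      split_ifs with hu hv
      · subst hu; simpa using h1
      · subst hv; simpa using h2
      · exact h3 i ⟨hu, hv⟩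
    · intro h
      refine ⟨by simpa using h u, by simpa [huv.symm] using h v, fun i hi => ?_⟩
      simpa [hi.1, hi.2] using h i
  rw [hs, measureReal_def, attrMeasure, Measure.pi_pi, ENNReal.toReal_prod,
    ← Finset.prod_mul_prod_compl ({u, v} : Finset (Fin n)), Finset.prod_pair huv]
  congr 1
  · simp [t, huv.symm, wt_eq_real, measureReal_def]
  · refine Finset.prod_congr rfl fun i hi => ?_
    simp only [Finset.mem_compl, Finset.mem_insert, Finset.mem_singleton, not_or] at hi
    simp [t, hi.1, hi.2, measureReal_def]

theorem jointHit_eq_real (A B : Finset (Fin m)) :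
    jointHit P A B = (attrLaw P).toMeasure.real {C | ¬Disjoint A C ∧ ¬Disjoint B C} := by
  rw [toMeasure_attrLaw_real, jointHit]

/-- Prescribing the exact set `R` of common neighbours turns the event into a box: every vertex of
`R` must hit both `A` and `B`, every other one must fail to. Independence then factorises the
probability. -/
theorem attrMeasure_real_commonFinset_eq {n : ℕ} {u v : Fin n} (huv : u ≠ v)
    (A B : Finset (Fin m)) {R : Finset (Fin n)} (hR : R ⊆ {u, v}ᶜ) :
    (attrMeasure n P).real {D | D u = A ∧ D v = B ∧ commonFinset u v D = R} =
      wt P A * wt P B * (jointHit P A B ^ R.card * (1 - jointHit P A B) ^ (n - 2 - R.card)) := by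
  let H : Set (Finset (Fin m)) := {C | ¬Disjoint A C ∧ ¬Disjoint B C}
  have hs : {D : Fin n → Finset (Fin m) | D u = A ∧ D v = B ∧ commonFinset u v D = R} =
      {D | D u = A ∧ D v = B ∧ ∀ i ∈ ({u, v}ᶜ : Finset (Fin n)),
        D i ∈ if i ∈ R then H else Hᶜ} := by
    ext D
    simp only [Set.mem_ofPred_eq]
    refine and_congr_right fun hA => and_congr_right fun hB => ?_
    rw [commonFinset, hA, hB, Finset.ext_iff]
    refine forall_congr' fun i => ?_
    rw [Finset.mem_filter]
    have hRi : i ∈ R → i ∈ ({u, v}ᶜ : Finset (Fin n)) := fun h => hR h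
    split_ifs with h
    · simp only [H, Set.mem_ofPred_eq]; tauto
    · simp only [H, Set.mem_compl_iff, Set.mem_ofPred_eq]; tauto
  rw [hs, attrMeasure_real_cylinder P huv]
  congr 1
  have hcard : (({u, v}ᶜ : Finset (Fin n)) \ R).card = n - 2 - R.card := by
    rw [Finset.card_sdiff_of_subset hR, Finset.card_compl, Finset.card_pair huv, Fintype.card_fin]
  rw [← Finset.prod_sdiff hR, mul_comm, ← hcard]
  congr 1
  · rw [Finset.prod_congr rfl (g := fun _ => jointHit P A B), Finset.prod_const]
    intro i hi
    rw [if_pos hi, jointHit_eq_real]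
  · rw [Finset.prod_congr rfl (g := fun _ => 1 - jointHit P A B), Finset.prod_const]
    intro i hi
    rw [if_neg (Finset.mem_sdiff.1 hi).2, jointHit_eq_real,
      probReal_compl_eq_one_sub (MeasurableSet.of_discrete)]

/-- Given the attribute sets of `u` and `v`, the number of their common neighbours is binomial. -/
theorem attrMeasure_real_common {n : ℕ} {u v : Fin n} (huv : u ≠ v)
    (Q : Finset (Fin m) → Finset (Fin m) → Prop) [∀ A B, Decidable (Q A B)] (r : ℕ) :
    (attrMeasure n P).real {D | Q (D u) (D v) ∧ (commonFinset u v D).card = r} =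
      pairEx P fun A B => if Q A B then binMass (n - 2) r (jointHit P A B) else 0 := by
  let F : (Fin n → Finset (Fin m)) → Finset (Fin m) × Finset (Fin m) × Finset (Fin n) :=
    fun D => (D u, D v, commonFinset u v D)
  let S : Finset (Finset (Fin m) × Finset (Fin m) × Finset (Fin n)) :=
    (Finset.univ ×ˢ Finset.univ ×ˢ Finset.powersetCard r {u, v}ᶜ).filter fun x => Q x.1 x.2.1
  have hs : {D : Fin n → Finset (Fin m) | Q (D u) (D v) ∧ (commonFinset u v D).card = r} =
      F ⁻¹' (S : Set _) := by
    ext D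
    have : commonFinset u v D ⊆ {u, v}ᶜ := Finset.filter_subset _ _
    simp only [F, S, Set.mem_preimage, Finset.mem_coe, Finset.mem_filter, Finset.mem_product,
      Finset.mem_univ, Finset.mem_powersetCard, this, true_and, and_comm, Set.mem_ofPred_eq]
  rw [hs, ← sum_measureReal_preimage_singleton S (fun _ _ => MeasurableSet.of_discrete),
    Finset.sum_filter, Finset.sum_product, pairEx]
  refine Finset.sum_congr rfl fun A _ => ?_
  rw [Finset.sum_product]
  refine Finset.sum_congr rfl fun B _ => ?_
  dsimp only
  split_ifs with hQ
  · rw [Finset.sum_congr rfl (g := fun _ => wt P A * wt P B *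
      (jointHit P A B ^ r * (1 - jointHit P A B) ^ (n - 2 - r))), Finset.sum_const,
      Finset.card_powersetCard, Finset.card_compl, Finset.card_pair huv, Fintype.card_fin, binMass,
      nsmul_eq_mul]
    · ring
    · intro R hR
      rw [Finset.mem_powersetCard] at hR
      rw [← hR.2, ← attrMeasure_real_commonFinset_eq P huv A B hR.1]
      congr 1
      ext D
      simp [F]
  · simp

theorem attrMeasure_real_pair {n : ℕ} {u v : Fin n} (huv : u ≠ v)
    (Q : Finset (Fin m) → Finset (Fin m) → Prop) [∀ A B, Decidable (Q A B)] :
    (attrMeasure n P).real {D | Q (D u) (D v)} = pairEx P fun A B => if Q A B then 1 else 0 := by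
  let F : (Fin n → Finset (Fin m)) → Finset (Fin m) × Finset (Fin m) := fun D => (D u, D v)
  let S : Finset (Finset (Fin m) × Finset (Fin m)) :=
    (Finset.univ ×ˢ Finset.univ).filter fun x => Q x.1 x.2
  have hs : {D : Fin n → Finset (Fin m) | Q (D u) (D v)} = F ⁻¹' (S : Set _) := by
    ext D
    simp [F, S]
  rw [hs, ← sum_measureReal_preimage_singleton S (fun _ _ => MeasurableSet.of_discrete),
    Finset.sum_filter, Finset.sum_product, pairEx]
  refine Finset.sum_congr rfl fun A _ => Finset.sum_congr rfl fun B _ => ?_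
  dsimp only
  split_ifs with hQ
  · have h := attrMeasure_real_cylinder P huv A B (fun _ => Set.univ)
    simp only [Set.mem_univ, implies_true, and_true, probReal_univ, Finset.prod_const_one,
      mul_one] at h
    rw [mul_one, ← h]
    congr 1
    ext D
    simp [F]
  · simp

/-- The probability that two given vertices are adjacent and have `r` common neighbours. -/
def adjProb (n r : ℕ) : ℝ :=
  pairEx P fun A B => if ¬Disjoint A B then binMass (n - 2) r (jointHit P A B) else 0

/-- The probability that two given vertices are not adjacent and have `r` common neighbours. -/
def nonadjProb (n r : ℕ) : ℝ :=
  pairEx P fun A B => if Disjoint A B then binMass (n - 2) r (jointHit P A B) else 0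

/-- The random pair is averaged out by Fubini. Since the attribute sets are i.i.d., the events of
interest have the same probability for every fixed pair, so it is enough to treat one pair. -/
theorem jointLaw_real_eq {n : ℕ} (hn : 2 ≤ n)
    (E : Set ((Fin n → Finset (Fin m)) × (Fin n × Fin n))) (c : ℝ)
    (hE : ∀ u v : Fin n, u ≠ v → (attrMeasure n P).real {D | (D, (u, v)) ∈ E} = c) :
    (jointLaw n P).real E = c := by
  have hne : ({p : Fin n × Fin n | p.1 ≠ p.2} : Set _).Nonempty :=
    ⟨(⟨0, by omega⟩, ⟨1, by omega⟩), by simp⟩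
  have := isProbabilityMeasure_uniformOn (Set.toFinite {p : Fin n × Fin n | p.1 ≠ p.2}) hne
  have h0 : 0 ≤ c := by
    rw [← hE ⟨0, by omega⟩ ⟨1, by omega⟩ (by simp)]; exact measureReal_nonneg
  rw [measureReal_def, jointLaw, Measure.prod_apply_symm MeasurableSet.of_discrete]
  have hae : ∀ᵐ p ∂(uniformOn {p : Fin n × Fin n | p.1 ≠ p.2}),
      attrMeasure n P ((fun D => (D, p)) ⁻¹' E) = ENNReal.ofReal c := by
    have : ∀ᵐ p ∂(uniformOn {p : Fin n × Fin n | p.1 ≠ p.2}), p ∈ {p : Fin n × Fin n | p.1 ≠ p.2} :=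
      ae_cond_mem MeasurableSet.of_discrete
    filter_upwards [this] with p hp
    rw [← hE p.1 p.2 hp, measureReal_def, ENNReal.ofReal_toReal (measure_ne_top _ _)]
    rfl
  rw [lintegral_congr_ae hae, lintegral_const, measure_univ, mul_one, ENNReal.toReal_ofReal h0]

theorem jointLaw_real_adj_inter_common {n : ℕ} (hn : 2 ≤ n) (r : ℕ) :
    (jointLaw n P).real (commonEvent n m r ∩ adjEvent n m) = adjProb P n r := by
  refine jointLaw_real_eq P hn _ _ fun u v huv => ?_
  rw [adjProb, ← attrMeasure_real_common P huv]
  congr 1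
  ext D
  have hadj : (intersectionGraph D).Adj u v ↔ ¬Disjoint (D u) (D v) := by
    simp [intersectionGraph, huv]
  simp only [commonEvent, adjEvent, Set.mem_inter_iff, Set.mem_ofPred_eq, ncard_commonNeighbors,
    hadj, and_comm]

theorem pairEx_add (f g : Finset (Fin m) → Finset (Fin m) → ℝ) :
    pairEx P (fun A B => f A B + g A B) = pairEx P f + pairEx P g := by
  simp only [pairEx, mul_add, Finset.sum_add_distrib]

theorem jointLaw_real_common {n : ℕ} (hn : 2 ≤ n) (r : ℕ) :
    (jointLaw n P).real (commonEvent n m r) = adjProb P n r + nonadjProb P n r := by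
  rw [adjProb, nonadjProb, ← pairEx_add]
  refine jointLaw_real_eq P hn _ _ fun u v huv => ?_
  have h := attrMeasure_real_common P huv (fun _ _ => True) r
  simp only [true_and, if_true] at h
  simp only [commonEvent, Set.mem_ofPred_eq, ncard_commonNeighbors]
  rw [h]
  congr 1
  ext A B
  by_cases hd : Disjoint A B <;> simp [hd]

theorem cl_eq {n : ℕ} (hn : 2 ≤ n) (r : ℕ) :
    cl n P r = adjProb P n r / (adjProb P n r + nonadjProb P n r) := by
  rw [cl, measureReal_def, cond_apply MeasurableSet.of_discrete, ENNReal.toReal_mul,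
    ENNReal.toReal_inv, ← measureReal_def, ← measureReal_def, jointLaw_real_adj_inter_common P hn,
    jointLaw_real_common P hn, div_eq_inv_mul]

theorem edgeProb_eq {n : ℕ} (hn : 2 ≤ n) :
    edgeProb n P = pairEx P fun A B => if ¬Disjoint A B then 1 else 0 := by
  rw [edgeProb, dif_pos hn]
  have huv : (⟨0, by omega⟩ : Fin n) ≠ ⟨1, by omega⟩ := by simp
  rw [← attrMeasure_real_pair P huv]
  congr 1
  ext D
  simp [intersectionGraph]

end

/-! ### Moments of random attribute sets and bounds on the hitting probability -/

/-- The expectation of `g X` for `X` of law `P`. -/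
def sizeEx {m : ℕ} (P : PMF (Fin (m + 1))) (g : ℕ → ℝ) : ℝ :=
  ∑ k : Fin (m + 1), (P k).toReal * g k

section

variable {m : ℕ} (P : PMF (Fin (m + 1)))

theorem sizeEx_mono {f g : ℕ → ℝ} (h : ∀ k ≤ m, f k ≤ g k) : sizeEx P f ≤ sizeEx P g :=
  Finset.sum_le_sum fun k _ => mul_le_mul_of_nonneg_left (h k (Nat.lt_succ_iff.1 k.2))
    ENNReal.toReal_nonneg

theorem sizeEx_nonneg {g : ℕ → ℝ} (h : ∀ k, 0 ≤ g k) : 0 ≤ sizeEx P g :=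
  Finset.sum_nonneg fun k _ => mul_nonneg ENNReal.toReal_nonneg (h k)

theorem sizeEx_const_mul (c : ℝ) (g : ℕ → ℝ) :
    sizeEx P (fun k => c * g k) = c * sizeEx P g := by
  simp only [sizeEx, Finset.mul_sum]
  exact Finset.sum_congr rfl fun _ _ => by ring

theorem sizeEx_sub (f g : ℕ → ℝ) :
    sizeEx P (fun k => f k - g k) = sizeEx P f - sizeEx P g := by
  simp only [sizeEx, mul_sub, Finset.sum_sub_distrib]

/-- Given `|A| = k`, the set `A` is uniform, so it contains a fixed `t`-set with probability `C(k,
t) / C(m, t)`. All moment computations below are the cases `t ≤ 3`. -/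
theorem sum_wt_superset (T : Finset (Fin m)) (g : ℕ → ℝ) :
    ∑ A, wt P A * (if T ⊆ A then g A.card else 0) =
      sizeEx P fun k => (k.choose T.card : ℝ) / m.choose T.card * g k := by
  set t := T.card with ht
  have htm : t ≤ m := by simpa using T.card_le_univ
  let p : ℕ → ℝ := fun k => if h : k < m + 1 then (P ⟨k, h⟩).toReal else 0
  let F : ℕ → ℝ := fun k => (m.choose k : ℝ)⁻¹ * p k * g k
  have hwt : ∀ A : Finset (Fin m), wt P A = (m.choose A.card : ℝ)⁻¹ * p A.card := by
    intro A
    have hA : A.card < m + 1 := Nat.lt_succ_of_le (by simpa using A.card_le_univ)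
    simp only [wt, attrLaw, PMF.ofFintype_apply, attrMass, ENNReal.toReal_mul, ENNReal.toReal_inv,
      ENNReal.toReal_natCast, p, dif_pos hA]
  have h1 : ∑ A, wt P A * (if T ⊆ A then g A.card else 0) =
      ∑ B ∈ Tᶜ.powerset, F (B.card + t) := by
    rw [Finset.sum_congr rfl (g := fun A => if T ⊆ A then F A.card else 0), ← Finset.sum_filter]
    · refine Finset.sum_bij' (fun A _ => A \ T) (fun B _ => B ∪ T) ?_ ?_ ?_ ?_ ?_
      · intro A _
        simp only [Finset.mem_powerset]
        intro x; simp
      · intro B _; simp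
      · intro A hA
        exact Finset.sdiff_union_of_subset (Finset.mem_filter.1 hA).2
      · intro B hB
        have : Disjoint B T := Finset.disjoint_left.2 fun x hx =>
          Finset.mem_compl.1 (Finset.mem_powerset.1 hB hx)
        rw [Finset.union_sdiff_right, Finset.sdiff_eq_self_of_disjoint this]
      · intro A hA
        rw [ht, Finset.card_sdiff_add_card_eq_card (Finset.mem_filter.1 hA).2]
    · intro A _
      rw [hwt]
      split_ifs
      · rfl
      · simp
  have h2 : sizeEx P (fun k => (k.choose t : ℝ) / m.choose t * g k) =
      ∑ k ∈ Finset.range (m + 1), p k * ((k.choose t : ℝ) / m.choose t * g k) := by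
    rw [Finset.sum_range, sizeEx]
    refine Finset.sum_congr rfl fun k _ => ?_
    simp only [p, dif_pos k.2]
  have h3 : ∑ k ∈ Finset.range t, p k * ((k.choose t : ℝ) / m.choose t * g k) = 0 := by
    refine Finset.sum_eq_zero fun k hk => ?_
    rw [Nat.choose_eq_zero_of_lt (Finset.mem_range.1 hk)]
    simp
  rw [h1, Finset.sum_powerset_apply_card (fun j => F (j + t)), h2, Finset.card_compl,
    Fintype.card_fin, ← ht, show m + 1 = t + (m - t + 1) by omega,
    Finset.sum_range_add _ t, h3, zero_add]
  refine Finset.sum_congr rfl fun j hj => ?_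
  have hj : j + t ≤ m := by have := Finset.mem_range.1 hj; omega
  -- The identity `C(m, k) C(k, t) = C(m, t) C(m - t, k - t)`, with `k = j + t`, matches the two
  -- sums term by term.
  have hc := Nat.choose_mul (n := m) (k := j + t) (s := t) (by omega)
  rw [Nat.add_sub_cancel] at hc
  have hc' : (m.choose (j + t) : ℝ) * (j + t).choose t = m.choose t * (m - t).choose j := by
    exact_mod_cast hc
  have h0 : (m.choose (j + t) : ℝ) ≠ 0 := by exact_mod_cast (Nat.choose_pos hj).ne'
  have h0' : (m.choose t : ℝ) ≠ 0 := by exact_mod_cast (Nat.choose_pos htm).ne'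
  rw [nsmul_eq_mul, add_comm t j]
  simp only [F]
  field_simp
  linear_combination (-g (j + t)) * p (j + t) * hc'

/-- Factor by factor, `(k - i) / (m - i) ≤ k / m` for `k ≤ m`. -/
theorem descFactorial_mul_pow_le {k m : ℕ} (h : k ≤ m) (t : ℕ) :
    k.descFactorial t * m ^ t ≤ m.descFactorial t * k ^ t := by
  induction t with
  | zero => simp
  | succ t ih =>
    rw [Nat.descFactorial_succ, Nat.descFactorial_succ, pow_succ, pow_succ]
    have : (k - t) * m ≤ (m - t) * k := by
      rw [Nat.sub_mul, Nat.sub_mul, mul_comm m k]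
      exact Nat.sub_le_sub_left (Nat.mul_le_mul_left t h) _
    calc (k - t) * k.descFactorial t * (m ^ t * m)
        = ((k - t) * m) * (k.descFactorial t * m ^ t) := by ring
      _ ≤ ((m - t) * k) * (m.descFactorial t * k ^ t) := Nat.mul_le_mul this ih
      _ = _ := by ring

theorem choose_div_choose_le {k m t : ℕ} (h : k ≤ m) (ht : t ≤ m) :
    (k.choose t : ℝ) / m.choose t ≤ (k / m : ℝ) ^ t := by
  rcases Nat.eq_zero_or_pos t with rfl | htpos
  · simp
  have hm : (0 : ℝ) < m := by exact_mod_cast (by omega : 0 < m)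
  have h0 : (0 : ℝ) < m.choose t := by exact_mod_cast Nat.choose_pos ht
  rw [div_pow, div_le_div_iff₀ h0 (by positivity)]
  have hd := descFactorial_mul_pow_le h t
  rw [Nat.descFactorial_eq_factorial_mul_choose, Nat.descFactorial_eq_factorial_mul_choose,
    mul_assoc, mul_assoc] at hd
  have := Nat.le_of_mul_le_mul_left hd t.factorial_pos
  rw [mul_comm ((k : ℝ) ^ t)]
  exact_mod_cast this

/-- The indicator of `a ∈ A`. -/
def mem01 (a : Fin m) (A : Finset (Fin m)) : ℝ := if a ∈ A then 1 else 0

theorem mem01_nonneg (a : Fin m) (A : Finset (Fin m)) : 0 ≤ mem01 a A := by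
  unfold mem01; split_ifs <;> norm_num

theorem mem01_mul_self (a : Fin m) (A : Finset (Fin m)) : mem01 a A * mem01 a A = mem01 a A := by
  unfold mem01; split_ifs <;> norm_num

theorem sum_wt_card (g : ℕ → ℝ) : ∑ A, wt P A * g A.card = sizeEx P g := by
  simpa using sum_wt_superset P ∅ g

theorem sum_wt_mem (a : Fin m) (g : ℕ → ℝ) :
    ∑ A, wt P A * (g A.card * mem01 a A) = sizeEx P (fun k => k * g k) / m := by
  have h := sum_wt_superset P {a} g
  rw [Finset.card_singleton] at h
  rw [div_eq_inv_mul, ← sizeEx_const_mul]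
  refine Eq.trans (Finset.sum_congr rfl fun A _ => ?_) (h.trans ?_)
  · simp [mem01]
  · congr 1; ext k; simp; ring

theorem sum_wt_mem_mem {a b : Fin m} (hab : a ≠ b) (g : ℕ → ℝ) :
    ∑ A, wt P A * (g A.card * (mem01 a A * mem01 b A)) =
      sizeEx P (fun k => k * (k - 1) * g k) / (m * (m - 1)) := by
  have h := sum_wt_superset P {a, b} g
  rw [Finset.card_pair hab] at h
  rw [div_eq_inv_mul, ← sizeEx_const_mul]
  refine Eq.trans (Finset.sum_congr rfl fun A _ => ?_) (h.trans ?_)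
  · by_cases ha : a ∈ A <;> by_cases hb : b ∈ A <;> simp [mem01, Finset.insert_subset_iff, ha, hb]
  · congr 1; ext k
    rw [Nat.cast_choose_two, Nat.cast_choose_two, div_div_div_cancel_right₀ (by norm_num)]
    ring

theorem sum_wt_mem_mem_le {a b : Fin m} (hab : a ≠ b) {g : ℕ → ℝ} (hg : ∀ k, 0 ≤ g k) :
    ∑ A, wt P A * (g A.card * (mem01 a A * mem01 b A)) ≤
      sizeEx P (fun k => k ^ 2 * g k) / m ^ 2 := by
  have h := sum_wt_superset P {a, b} g
  rw [div_eq_inv_mul, ← sizeEx_const_mul]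
  refine Eq.trans_le (Eq.trans (Finset.sum_congr rfl fun A _ => ?_) h) (sizeEx_mono P ?_)
  · by_cases ha : a ∈ A <;> by_cases hb : b ∈ A <;> simp [mem01, Finset.insert_subset_iff, ha, hb]
  · intro k hk
    have h2 := choose_div_choose_le hk (by simpa using ({a, b} : Finset (Fin m)).card_le_univ)
    rw [Finset.card_pair hab] at h2 ⊢
    calc _ ≤ (k / m : ℝ) ^ 2 * g k := mul_le_mul_of_nonneg_right h2 (hg k)
      _ = _ := by ring

theorem sum_wt_mem_mem_mem_le {a b c : Fin m} (hab : a ≠ b) (hac : a ≠ c) (hbc : b ≠ c)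
    {g : ℕ → ℝ} (hg : ∀ k, 0 ≤ g k) :
    ∑ A, wt P A * (g A.card * (mem01 a A * mem01 b A * mem01 c A)) ≤
      sizeEx P (fun k => k ^ 3 * g k) / m ^ 3 := by
  have h := sum_wt_superset P {a, b, c} g
  rw [div_eq_inv_mul, ← sizeEx_const_mul]
  refine Eq.trans_le (Eq.trans (Finset.sum_congr rfl fun A _ => ?_) h) (sizeEx_mono P ?_)
  · by_cases ha : a ∈ A <;> by_cases hb : b ∈ A <;> by_cases hc : c ∈ A <;>
      simp [mem01, Finset.insert_subset_iff, ha, hb, hc]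
  · intro k hk
    have h2 := choose_div_choose_le hk (by simpa using ({a, b, c} : Finset (Fin m)).card_le_univ)
    rw [Finset.card_eq_three.2 ⟨a, b, c, hab, hac, hbc, rfl⟩] at h2 ⊢
    calc _ ≤ (k / m : ℝ) ^ 3 * g k := mul_le_mul_of_nonneg_right h2 (hg k)
      _ = _ := by ring

theorem card_eq_sum_mem01 (A : Finset (Fin m)) : (A.card : ℝ) = ∑ a, mem01 a A := by
  simp [mem01]

theorem card_inter_eq_sum_mem01 (A B : Finset (Fin m)) :
    ((A ∩ B).card : ℝ) = ∑ a, mem01 a A * mem01 a B := by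
  rw [card_eq_sum_mem01]
  refine Finset.sum_congr rfl fun a _ => ?_
  by_cases ha : a ∈ A <;> by_cases hb : a ∈ B <;> simp [mem01, ha, hb]

theorem not_disjoint_iff_one_le_card_inter (A B : Finset (Fin m)) :
    ¬Disjoint A B ↔ 1 ≤ (A ∩ B).card := by
  rw [Finset.not_disjoint_iff_nonempty_inter, Finset.one_le_card]

theorem jointHit_nonneg (A B : Finset (Fin m)) : 0 ≤ jointHit P A B :=
  Finset.sum_nonneg fun C _ => mul_nonneg (wt_nonneg P C) (by split_ifs <;> norm_num)

theorem jointHit_le_one (A B : Finset (Fin m)) : jointHit P A B ≤ 1 := by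
  rw [← sum_wt P]
  refine Finset.sum_le_sum fun C _ => ?_
  have := wt_nonneg P C
  split_ifs <;> simp [this]

theorem card_inter_eq_sum_subset (A C : Finset (Fin m)) :
    ((A ∩ C).card : ℝ) = ∑ a ∈ A, mem01 a C := by
  simp [mem01, ← Finset.filter_mem_eq_inter]

/-- Union bound over `(a, b) ∈ A × B` with both elements in `C`. The diagonal `a = b` contributes
`|A ∩ B|` terms of size `E X / m`; each remaining pair costs at most `E X² / m²`. -/
theorem jointHit_le (A B : Finset (Fin m)) :
    jointHit P A B ≤ (A ∩ B).card * (sizeEx P (fun k => k) / m) +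
      A.card * B.card * (sizeEx P (fun k => k ^ 2) / m ^ 2) := by
  have hpt : ∀ C : Finset (Fin m), (if ¬Disjoint A C ∧ ¬Disjoint B C then (1 : ℝ) else 0) ≤
      ∑ a ∈ A, ∑ b ∈ B, mem01 a C * mem01 b C := by
    intro C
    rw [← Finset.sum_mul_sum, ← card_inter_eq_sum_subset, ← card_inter_eq_sum_subset]
    simp only [not_disjoint_iff_one_le_card_inter]
    split_ifs with h
    · exact_mod_cast Nat.mul_le_mul h.1 h.2
    · positivity
  have hsum : ∑ C, wt P C * ∑ a ∈ A, ∑ b ∈ B, mem01 a C * mem01 b C =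
      ∑ a ∈ A, ∑ b ∈ B, ∑ C, wt P C * (mem01 a C * mem01 b C) := by
    simp only [Finset.mul_sum]
    rw [Finset.sum_comm]
    exact Finset.sum_congr rfl fun a _ => Finset.sum_comm
  have hterm : ∀ a b : Fin m, ∑ C, wt P C * (mem01 a C * mem01 b C) ≤
      (if a = b then sizeEx P (fun k => k) / m else 0) + sizeEx P (fun k => k ^ 2) / m ^ 2 := by
    intro a b
    have hs2 : 0 ≤ sizeEx P (fun k => k ^ 2) / m ^ 2 :=
      div_nonneg (sizeEx_nonneg P fun k => by positivity) (by positivity)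
    split_ifs with h
    · subst h
      have := sum_wt_mem P a (fun _ => 1)
      simp only [mul_one, one_mul] at this
      simp only [mem01_mul_self, this]
      linarith
    · have := sum_wt_mem_mem_le P h (g := fun _ => 1) (fun _ => zero_le_one)
      simpa using this
  calc jointHit P A B ≤ ∑ C, wt P C * ∑ a ∈ A, ∑ b ∈ B, mem01 a C * mem01 b C :=
        Finset.sum_le_sum fun C _ => mul_le_mul_of_nonneg_left (hpt C) (wt_nonneg P C)
    _ = ∑ a ∈ A, ∑ b ∈ B, ∑ C, wt P C * (mem01 a C * mem01 b C) := hsum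
    _ ≤ ∑ a ∈ A, ∑ b ∈ B, ((if a = b then sizeEx P (fun k => k) / m else 0) +
          sizeEx P (fun k => k ^ 2) / m ^ 2) :=
        Finset.sum_le_sum fun a _ => Finset.sum_le_sum fun b _ => hterm a b
    _ = _ := by
        simp only [Finset.sum_add_distrib, Finset.sum_const, Finset.sum_ite_eq, nsmul_eq_mul]
        rw [← Finset.sum_filter, Finset.filter_mem_eq_inter, Finset.sum_const, nsmul_eq_mul]
        ring

theorem le_jointHit_of_not_disjoint {A B : Finset (Fin m)} (h : ¬Disjoint A B) :
    sizeEx P (fun k => k) / m ≤ jointHit P A B := by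
  obtain ⟨a, ha, hb⟩ := Finset.not_disjoint_iff.1 h
  have := sum_wt_mem P a (fun _ => 1)
  simp only [mul_one, one_mul] at this
  rw [← this]
  refine Finset.sum_le_sum fun C _ => mul_le_mul_of_nonneg_left ?_ (wt_nonneg P C)
  unfold mem01
  split_ifs with h1 h2 h2
  · exact le_rfl
  · exact absurd ⟨Finset.not_disjoint_iff.2 ⟨a, ha, h1⟩, Finset.not_disjoint_iff.2 ⟨a, hb, h1⟩⟩ h2
  · exact zero_le_one
  · exact le_rfl

/-- For disjoint `A`, `B` every pair `(a, b)` has `a ≠ b`, so no diagonal term occurs and the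
expectation is exact. -/
theorem sum_wt_card_inter_mul {A B : Finset (Fin m)} (hAB : Disjoint A B) (g : ℕ → ℝ) :
    ∑ C, wt P C * (g C.card * ((A ∩ C).card * (B ∩ C).card)) =
      A.card * B.card * (sizeEx P (fun k => k * (k - 1) * g k) / (m * (m - 1))) := by
  have hpt : ∀ C : Finset (Fin m), wt P C * (g C.card * ((A ∩ C).card * (B ∩ C).card)) =
      ∑ a ∈ A, ∑ b ∈ B, wt P C * (g C.card * (mem01 a C * mem01 b C)) := by
    intro C
    rw [card_inter_eq_sum_subset, card_inter_eq_sum_subset, Finset.sum_mul_sum]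
    simp only [Finset.mul_sum]
  rw [Finset.sum_congr rfl fun C _ => hpt C, Finset.sum_comm]
  rw [Finset.sum_congr rfl fun a _ => Finset.sum_comm]
  rw [Finset.sum_congr rfl fun a ha => Finset.sum_congr rfl fun b hb => sum_wt_mem_mem P
    (fun h : a = b => Finset.disjoint_left.1 hAB ha (h ▸ hb)) g]
  simp only [Finset.sum_const, nsmul_eq_mul]
  ring

theorem sum_wt_card_inter_mul_pred_le {A B : Finset (Fin m)} (hAB : Disjoint A B) {g : ℕ → ℝ}
    (hg : ∀ k, 0 ≤ g k) :
    ∑ C, wt P C * (g C.card * ((A ∩ C).card * ((A ∩ C).card - 1) * (B ∩ C).card)) ≤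
      A.card ^ 2 * B.card * (sizeEx P (fun k => k ^ 3 * g k) / m ^ 3) := by
  have hpt : ∀ C : Finset (Fin m),
      wt P C * (g C.card * ((A ∩ C).card * ((A ∩ C).card - 1) * (B ∩ C).card)) =
      ∑ a ∈ A, ∑ a' ∈ A, ∑ b ∈ B, wt P C * (g C.card *
        ((if a = a' then 0 else mem01 a C * mem01 a' C) * mem01 b C)) := by
    intro C
    have h1 : ((A ∩ C).card : ℝ) * ((A ∩ C).card - 1) =
        ∑ a ∈ A, ∑ a' ∈ A, if a = a' then 0 else mem01 a C * mem01 a' C := by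
      have h2 : ∀ a ∈ A, ∑ a' ∈ A, (if a = a' then 0 else mem01 a C * mem01 a' C) =
          mem01 a C * (A ∩ C).card - mem01 a C := by
        intro a ha
        have h3 : ∀ a' ∈ A, (if a = a' then 0 else mem01 a C * mem01 a' C) =
            mem01 a C * mem01 a' C - if a = a' then mem01 a C else 0 := by
          intro a' _
          split_ifs with h
          · rw [← h, mem01_mul_self, sub_self]
          · rw [sub_zero]
        rw [Finset.sum_congr rfl h3, Finset.sum_sub_distrib, Finset.sum_ite_eq, if_pos ha,
          ← Finset.mul_sum, ← card_inter_eq_sum_subset]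
      rw [Finset.sum_congr rfl h2, Finset.sum_sub_distrib, ← Finset.sum_mul,
        ← card_inter_eq_sum_subset]
      ring
    rw [h1, card_inter_eq_sum_subset B C, Finset.sum_mul]
    simp only [Finset.mul_sum, Finset.sum_mul]
    exact Finset.sum_congr rfl fun a _ => Finset.sum_comm
  have hs3 : 0 ≤ sizeEx P (fun k => k ^ 3 * g k) / m ^ 3 :=
    div_nonneg (sizeEx_nonneg P fun k => mul_nonneg (by positivity) (hg k)) (by positivity)
  rw [Finset.sum_congr rfl fun C _ => hpt C, Finset.sum_comm]
  rw [Finset.sum_congr rfl fun a _ => Finset.sum_comm]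
  rw [Finset.sum_congr rfl fun a _ => Finset.sum_congr rfl fun a' _ => Finset.sum_comm]
  calc _ ≤ ∑ a ∈ A, ∑ a' ∈ A, ∑ b ∈ B, sizeEx P (fun k => k ^ 3 * g k) / m ^ 3 := by
        refine Finset.sum_le_sum fun a ha => Finset.sum_le_sum fun a' ha' =>
          Finset.sum_le_sum fun b hb => ?_
        split_ifs with h
        · simpa using hs3
        · exact sum_wt_mem_mem_mem_le P h
            (fun h : a = b => Finset.disjoint_left.1 hAB ha (h ▸ hb))
            (fun h : a' = b => Finset.disjoint_left.1 hAB ha' (h ▸ hb)) hg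
    _ = _ := by
        simp only [Finset.sum_const, nsmul_eq_mul]
        ring

/-- A Bonferroni-type inequality: if `x, y ≥ 1` and `x + y ≥ 3`, the two correction terms add up to
`x y (x + y - 2) ≥ x y`; the case `x = y = 1` is an equality. -/
theorem mul_le_indicator_add {x y : ℕ} :
    (x * y : ℝ) ≤ (if 1 ≤ x ∧ 1 ≤ y then 1 else 0) + x * (x - 1) * y + y * (y - 1) * x := by
  split_ifs with h
  · have hx : (1 : ℝ) ≤ x := by exact_mod_cast h.1
    have hy : (1 : ℝ) ≤ y := by exact_mod_cast h.2
    by_cases h3 : x + y ≤ 2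
    · have h1 : x = 1 := by omega
      have h2 : y = 1 := by omega
      subst h1; subst h2; norm_num
    · have h4 : (3 : ℝ) ≤ x + y := by exact_mod_cast (by omega : 3 ≤ x + y)
      nlinarith [mul_nonneg (mul_nonneg (zero_le_one.trans hx) (zero_le_one.trans hy))
        (sub_nonneg.2 h4)]
  · rcases Nat.eq_zero_or_pos x with rfl | hx
    · simp
    · have : y = 0 := by omega
      subst this; simp

/-- The Bonferroni inequality for `x = |A ∩ C|`, `y = |B ∩ C|`, averaged over `C`. The corrections
involve a third moment, which need not be controlled; the weight `g` on `|C|` is there to truncate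
it. -/
theorem le_jointHit_of_disjoint {A B : Finset (Fin m)} (hAB : Disjoint A B) {L : ℝ}
    (hA : A.card ≤ L) (hB : B.card ≤ L) {g : ℕ → ℝ} (hg : ∀ k, 0 ≤ g k) (hg1 : ∀ k, g k ≤ 1) :
    A.card * B.card * (sizeEx P (fun k => k * (k - 1) * g k) / (m * (m - 1)) -
      2 * L * (sizeEx P (fun k => k ^ 3 * g k) / m ^ 3)) ≤ jointHit P A B := by
  have hs3 : 0 ≤ sizeEx P (fun k => k ^ 3 * g k) / m ^ 3 :=
    div_nonneg (sizeEx_nonneg P fun k => mul_nonneg (by positivity) (hg k)) (by positivity)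
  have h1 := sum_wt_card_inter_mul P hAB g
  have h2 := sum_wt_card_inter_mul_pred_le P hAB hg
  have h3 := sum_wt_card_inter_mul_pred_le P hAB.symm hg
  have hpt : ∑ C, wt P C * (g C.card * ((A ∩ C).card * (B ∩ C).card)) ≤ jointHit P A B +
      ∑ C, wt P C * (g C.card * ((A ∩ C).card * ((A ∩ C).card - 1) * (B ∩ C).card)) +
      ∑ C, wt P C * (g C.card * ((B ∩ C).card * ((B ∩ C).card - 1) * (A ∩ C).card)) := by
    rw [jointHit, ← Finset.sum_add_distrib, ← Finset.sum_add_distrib]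
    refine Finset.sum_le_sum fun C _ => ?_
    rw [← mul_add, ← mul_add]
    refine mul_le_mul_of_nonneg_left ?_ (wt_nonneg P C)
    have h4 := mul_le_mul_of_nonneg_left (mul_le_indicator_add (x := (A ∩ C).card)
      (y := (B ∩ C).card)) (hg C.card)
    simp only [not_disjoint_iff_one_le_card_inter]
    have h5 : g C.card * (if 1 ≤ (A ∩ C).card ∧ 1 ≤ (B ∩ C).card then (1 : ℝ) else 0) ≤
        if 1 ≤ (A ∩ C).card ∧ 1 ≤ (B ∩ C).card then (1 : ℝ) else 0 := by
      split_ifs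
      · simpa using hg1 C.card
      · simp
    linarith
  set s3 := sizeEx P (fun k => k ^ 3 * g k) / m ^ 3
  have hA0 : (0 : ℝ) ≤ A.card := Nat.cast_nonneg _
  have hB0 : (0 : ℝ) ≤ B.card := Nat.cast_nonneg _
  have h6 : (A.card : ℝ) ^ 2 * B.card * s3 ≤ L * (A.card * B.card * s3) := by
    calc (A.card : ℝ) ^ 2 * B.card * s3 = A.card * (A.card * B.card * s3) := by ring
      _ ≤ _ := mul_le_mul_of_nonneg_right hA (by positivity)
  have h7 : (B.card : ℝ) ^ 2 * A.card * s3 ≤ L * (A.card * B.card * s3) := by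
    calc (B.card : ℝ) ^ 2 * A.card * s3 = B.card * (A.card * B.card * s3) := by ring
      _ ≤ _ := mul_le_mul_of_nonneg_right hB (by positivity)
  linarith

/-! ### Expectations over two independent attribute sets -/

theorem pairEx_mono {f g : Finset (Fin m) → Finset (Fin m) → ℝ} (h : ∀ A B, f A B ≤ g A B) :
    pairEx P f ≤ pairEx P g :=
  Finset.sum_le_sum fun A _ => Finset.sum_le_sum fun B _ =>
    mul_le_mul_of_nonneg_left (h A B) (mul_nonneg (wt_nonneg P A) (wt_nonneg P B))

theorem pairEx_nonneg {f : Finset (Fin m) → Finset (Fin m) → ℝ} (h : ∀ A B, 0 ≤ f A B) :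
    0 ≤ pairEx P f :=
  Finset.sum_nonneg fun A _ => Finset.sum_nonneg fun B _ =>
    mul_nonneg (mul_nonneg (wt_nonneg P A) (wt_nonneg P B)) (h A B)

theorem pairEx_const_mul (c : ℝ) (f : Finset (Fin m) → Finset (Fin m) → ℝ) :
    pairEx P (fun A B => c * f A B) = c * pairEx P f := by
  simp only [pairEx, Finset.mul_sum]
  exact Finset.sum_congr rfl fun _ _ => Finset.sum_congr rfl fun _ _ => by ring

theorem pairEx_sub (f g : Finset (Fin m) → Finset (Fin m) → ℝ) :
    pairEx P (fun A B => f A B - g A B) = pairEx P f - pairEx P g := by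
  simp only [pairEx, mul_sub, Finset.sum_sub_distrib]

theorem pairEx_sum {ι : Type*} (s : Finset ι) (f : ι → Finset (Fin m) → Finset (Fin m) → ℝ) :
    pairEx P (fun A B => ∑ i ∈ s, f i A B) = ∑ i ∈ s, pairEx P (f i) := by
  simp only [pairEx, Finset.mul_sum]
  rw [Finset.sum_comm]
  rw [Finset.sum_congr rfl fun B _ => Finset.sum_comm, Finset.sum_comm]
  exact Finset.sum_congr rfl fun i _ => Finset.sum_comm

theorem pairEx_mul (f g : Finset (Fin m) → ℝ) :
    pairEx P (fun A B => f A * g B) = (∑ A, wt P A * f A) * ∑ B, wt P B * g B := by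
  rw [pairEx, Finset.sum_mul_sum]
  exact Finset.sum_congr rfl fun _ _ => Finset.sum_congr rfl fun _ _ => by ring

theorem pairEx_card (f g : ℕ → ℝ) :
    pairEx P (fun A B => f A.card * g B.card) = sizeEx P f * sizeEx P g := by
  rw [pairEx_mul P (fun A => f A.card) (fun B => g B.card), sum_wt_card, sum_wt_card]

theorem pairEx_card_inter (f g : ℕ → ℝ) :
    pairEx P (fun A B => (A ∩ B).card * (f A.card * g B.card)) =
      sizeEx P (fun k => k * f k) * sizeEx P (fun k => k * g k) / m := by
  have h : ∀ A B : Finset (Fin m), ((A ∩ B).card : ℝ) * (f A.card * g B.card) =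
      ∑ a, (f A.card * mem01 a A) * (g B.card * mem01 a B) := by
    intro A B
    rw [card_inter_eq_sum_mem01, Finset.sum_mul]
    exact Finset.sum_congr rfl fun _ _ => by ring
  simp only [h]
  rw [pairEx_sum]
  rw [Finset.sum_congr rfl fun a _ => (pairEx_mul P (fun A => f A.card * mem01 a A)
    (fun B => g B.card * mem01 a B)).trans (congrArg₂ _ (sum_wt_mem P a f) (sum_wt_mem P a g))]
  rcases eq_or_ne m 0 with rfl | hm
  · simp
  · have : (m : ℝ) ≠ 0 := by exact_mod_cast hm
    simp only [Finset.sum_const, Finset.card_univ, Fintype.card_fin, nsmul_eq_mul]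
    field_simp

/-- Expand the square over pairs `(a, b)` of attributes: the `m` diagonal pairs give the first term,
the at most `m²` others the second. -/
theorem pairEx_card_inter_sq_le :
    pairEx P (fun A B => ((A ∩ B).card : ℝ) ^ 2) ≤
      sizeEx P (fun k => k) ^ 2 / m + (sizeEx P (fun k => k ^ 2) / m) ^ 2 := by
  have h : ∀ A B : Finset (Fin m), ((A ∩ B).card : ℝ) ^ 2 =
      ∑ a, ∑ b, (mem01 a A * mem01 b A) * (mem01 a B * mem01 b B) := by
    intro A B
    rw [card_inter_eq_sum_mem01, sq, Finset.sum_mul_sum]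
    exact Finset.sum_congr rfl fun _ _ => Finset.sum_congr rfl fun _ _ => by ring
  simp only [h]
  rw [pairEx_sum]
  have hterm : ∀ a b : Fin m,
      pairEx P (fun A B => (mem01 a A * mem01 b A) * (mem01 a B * mem01 b B)) ≤
      (if a = b then (sizeEx P (fun k => k) / m) ^ 2 else 0) +
        (sizeEx P (fun k => k ^ 2) / m ^ 2) ^ 2 := by
    intro a b
    rw [pairEx_mul P (fun A => mem01 a A * mem01 b A) (fun B => mem01 a B * mem01 b B), ← sq]
    split_ifs with hab
    · subst hab
      have := sum_wt_mem P a (fun _ => 1)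
      simp only [mul_one, one_mul] at this
      simp only [mem01_mul_self, this]
      exact le_add_of_nonneg_right (sq_nonneg _)
    · have := sum_wt_mem_mem_le P hab (g := fun _ => 1) (fun _ => zero_le_one)
      simp only [mul_one, one_mul] at this
      rw [zero_add]
      exact pow_le_pow_left₀ (Finset.sum_nonneg fun A _ => mul_nonneg (wt_nonneg P A)
        (mul_nonneg (mem01_nonneg _ _) (mem01_nonneg _ _))) this 2
  rw [Finset.sum_congr rfl fun a _ => pairEx_sum P _ _]
  refine (Finset.sum_le_sum fun a _ => Finset.sum_le_sum fun b _ => hterm a b).trans (le_of_eq ?_)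
  rcases eq_or_ne m 0 with rfl | hm
  · simp
  · have : (m : ℝ) ≠ 0 := by exact_mod_cast hm
    simp only [Finset.sum_add_distrib, Finset.sum_ite_eq, Finset.sum_const, Finset.card_univ,
      Fintype.card_fin, nsmul_eq_mul, Finset.mem_univ, if_true]
    field_simp

end

/-! ### Elementary bounds on binomial probabilities -/

section

variable {N r : ℕ} {q : ℝ}

theorem binMass_nonneg (h0 : 0 ≤ q) (h1 : q ≤ 1) : 0 ≤ binMass N r q := by
  have : 0 ≤ 1 - q := sub_nonneg.2 h1
  unfold binMass; positivity

theorem binMass_le_one (h0 : 0 ≤ q) (h1 : q ≤ 1) : binMass N r q ≤ 1 := by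
  rcases lt_or_ge N r with h | h
  · simp [binMass, Nat.choose_eq_zero_of_lt h]
  · have hs := add_pow q (1 - q) N
    rw [add_sub_cancel, one_pow] at hs
    rw [hs]
    have h2 : 0 ≤ 1 - q := sub_nonneg.2 h1
    refine le_of_eq_of_le ?_ (Finset.single_le_sum
      (f := fun k => q ^ k * (1 - q) ^ (N - k) * (N.choose k : ℝ)) (fun k _ => by positivity)
      (Finset.mem_range.2 (Nat.lt_succ_of_le h)))
    simp only [binMass]
    ring

theorem binMass_le (h0 : 0 ≤ q) (h1 : q ≤ 1) : binMass N r q ≤ N.choose r * q ^ r := by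
  have h2 : 0 ≤ 1 - q := sub_nonneg.2 h1
  exact mul_le_of_le_one_right (by positivity) (pow_le_one₀ h2 (by linarith))

theorem binMass_one_le (h0 : 0 ≤ q) (h1 : q ≤ 1) : binMass N 1 q ≤ N * q := by
  simpa using binMass_le (N := N) (r := 1) h0 h1

theorem binMass_two_le (h0 : 0 ≤ q) (h1 : q ≤ 1) : binMass N 2 q ≤ (N * q) ^ 2 / 2 := by
  refine (binMass_le h0 h1).trans ?_
  rw [Nat.cast_choose_two]
  have : (0 : ℝ) ≤ N * q ^ 2 := by positivity
  nlinarith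

/-- If `N q ≤ 1`, then `(N q)^r ≤ (N q)²`; otherwise the right side exceeds one. This handles all `r
≥ 2` with second moments alone. -/
theorem binMass_le_sq (h0 : 0 ≤ q) (h1 : q ≤ 1) (hr : 2 ≤ r) : binMass N r q ≤ (N * q) ^ 2 := by
  have hq : 0 ≤ N * q := by positivity
  rcases le_or_gt (N * q) 1 with h | h
  · have h2 : (N.choose r : ℝ) ≤ N ^ r := by exact_mod_cast Nat.choose_le_pow N r
    calc binMass N r q ≤ N.choose r * q ^ r := binMass_le h0 h1
      _ ≤ N ^ r * q ^ r := mul_le_mul_of_nonneg_right h2 (by positivity)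
      _ = (N * q) ^ r := (mul_pow _ _ _).symm
      _ ≤ (N * q) ^ 2 := pow_le_pow_of_le_one hq h hr
  · exact (binMass_le_one h0 h1).trans (one_le_pow₀ h.le)

/-- Bernoulli's inequality for `(1 - q)^(N - r)`; the separate lower bound `κ` allows `q^r` to be
estimated independently of this factor. -/
theorem le_binMass {κ : ℝ} (hκ : 0 ≤ κ) (hκq : κ ≤ q) (h1 : q ≤ 1) :
    N.choose r * κ ^ r * (1 - N * q) ≤ binMass N r q := by
  have h0 : 0 ≤ q := hκ.trans hκq
  rcases le_or_gt (1 - N * q) 0 with h | h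
  · exact (mul_nonpos_of_nonneg_of_nonpos (by positivity) h).trans (binMass_nonneg h0 h1)
  · have hb := one_add_mul_le_pow (a := -q) (by linarith) (N - r)
    have hN : ((N - r : ℕ) : ℝ) * q ≤ N * q :=
      mul_le_mul_of_nonneg_right (by exact_mod_cast Nat.sub_le N r) h0
    rw [← sub_eq_add_neg] at hb
    unfold binMass
    gcongr
    linarith

end

/-! ### Bounds for fixed `n` on the probabilities of adjacency and of common neighbours -/

section

variable {m : ℕ} (P : PMF (Fin (m + 1)))

theorem sum_wt_pair : pairEx P (fun _ _ => 1) = 1 := by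
  have := pairEx_mul P (fun _ => 1) (fun _ => 1)
  simpa [sum_wt] using this

theorem pairEx_card_inter_eq :
    pairEx P (fun A B => ((A ∩ B).card : ℝ)) = sizeEx P (fun k => k) ^ 2 / m := by
  have := pairEx_card_inter P (fun _ => 1) (fun _ => 1)
  simp only [mul_one] at this
  rw [this, sq]

theorem pairEx_card_inter_mul_card :
    pairEx P (fun A B => ((A ∩ B).card : ℝ) * (A.card * B.card)) =
      sizeEx P (fun k => k ^ 2) ^ 2 / m := by
  have := pairEx_card_inter P (fun k => k) (fun k => k)
  simp only [← sq] at this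
  rw [this]

theorem cast_one_le_card_inter {A B : Finset (Fin m)} (h : ¬Disjoint A B) :
    (1 : ℝ) ≤ (A ∩ B).card := by
  exact_mod_cast (not_disjoint_iff_one_le_card_inter A B).1 h

theorem card_inter_eq_zero {A B : Finset (Fin m)} (h : Disjoint A B) : (A ∩ B).card = 0 := by
  rw [Finset.card_eq_zero, Finset.disjoint_iff_inter_eq_empty.1 h]

theorem sizeEx_sq_div_nonneg : 0 ≤ sizeEx P (fun k => k ^ 2) / m ^ 2 :=
  div_nonneg (sizeEx_nonneg P fun k => by positivity) (by positivity)

theorem sizeEx_id_div_nonneg : 0 ≤ sizeEx P (fun k => k) / m :=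
  div_nonneg (sizeEx_nonneg P fun k => by positivity) (by positivity)

theorem edge_le : pairEx P (fun A B => if ¬Disjoint A B then 1 else 0) ≤
    sizeEx P (fun k => k) ^ 2 / m := by
  rw [← pairEx_card_inter_eq]
  refine pairEx_mono P fun A B => ?_
  split_ifs with h
  · positivity
  · exact cast_one_le_card_inter h

/-- With `s = |A ∩ B|`, the indicator of `s ≥ 1` is at least `2 s - s²`, because `(s - 1)² ≥ 0`. -/
theorem le_edge : sizeEx P (fun k => k) ^ 2 / m - (sizeEx P (fun k => k ^ 2) / m) ^ 2 ≤
    pairEx P (fun A B => if ¬Disjoint A B then 1 else 0) := by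
  have h : pairEx P (fun A B => 2 * ((A ∩ B).card : ℝ) - ((A ∩ B).card : ℝ) ^ 2) ≤
      pairEx P (fun A B => if ¬Disjoint A B then 1 else 0) := by
    refine pairEx_mono P fun A B => ?_
    split_ifs with h
    · simp [card_inter_eq_zero h]
    · nlinarith [sq_nonneg (((A ∩ B).card : ℝ) - 1)]
  rw [pairEx_sub, pairEx_const_mul, pairEx_card_inter_eq] at h
  have h2 := pairEx_card_inter_sq_le P
  linarith

/-- The bound for the expected number of common neighbours on the event of adjacency. -/
def adjBound (n : ℕ) : ℝ :=
  n * sizeEx P (fun k => k) ^ 3 / m ^ 2 + n * (sizeEx P (fun k => k ^ 2) / m) ^ 3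

theorem mul_jointHit_le (n : ℕ) (A B : Finset (Fin m)) : ((n - 2 : ℕ) : ℝ) * jointHit P A B ≤
    n * (sizeEx P (fun k => k) / m) * (A ∩ B).card +
      n * (sizeEx P (fun k => k ^ 2) / m ^ 2) * (A.card * B.card) := by
  have hn : ((n - 2 : ℕ) : ℝ) ≤ n := by exact_mod_cast Nat.sub_le n 2
  calc ((n - 2 : ℕ) : ℝ) * jointHit P A B ≤ n * jointHit P A B :=
        mul_le_mul_of_nonneg_right hn (jointHit_nonneg P A B)
    _ ≤ n * _ := mul_le_mul_of_nonneg_left (jointHit_le P A B) (Nat.cast_nonneg n)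
    _ = _ := by ring

theorem mul_jointHit_le_of_disjoint (n : ℕ) {A B : Finset (Fin m)} (h : Disjoint A B) :
    ((n - 2 : ℕ) : ℝ) * jointHit P A B ≤
      n * (sizeEx P (fun k => k ^ 2) / m ^ 2) * (A.card * B.card) := by
  simpa [card_inter_eq_zero h] using mul_jointHit_le P n A B

/-- On adjacency `1 ≤ |A ∩ B|`, so the term `|A| |B|` may be multiplied by `|A ∩ B|`. This yields
the small factor `1 / m` in its expectation while using only second moments. -/
theorem adjMean_le (n : ℕ) :
    pairEx P (fun A B => if ¬Disjoint A B then ((n - 2 : ℕ) : ℝ) * jointHit P A B else 0) ≤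
      adjBound P n := by
  have h : pairEx P (fun A B =>
      if ¬Disjoint A B then ((n - 2 : ℕ) : ℝ) * jointHit P A B else 0) ≤
      pairEx P (fun A B => n * (sizeEx P (fun k => k) / m) * ((A ∩ B).card : ℝ) +
        n * (sizeEx P (fun k => k ^ 2) / m ^ 2) * ((A ∩ B).card * (A.card * B.card))) := by
    refine pairEx_mono P fun A B => ?_
    have h1 := sizeEx_sq_div_nonneg P
    have h2 := sizeEx_id_div_nonneg P
    split_ifs with hd
    · positivity
    · refine (mul_jointHit_le P n A B).trans ?_
      exact add_le_add le_rfl (mul_le_mul_of_nonneg_left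
        (le_mul_of_one_le_left (by positivity) (cast_one_le_card_inter hd)) (by positivity))
  refine h.trans (le_of_eq ?_)
  rw [pairEx_add, pairEx_const_mul, pairEx_const_mul, pairEx_card_inter_eq,
    pairEx_card_inter_mul_card, adjBound]
  ring

theorem adjProb_one_le (n : ℕ) : adjProb P n 1 ≤ adjBound P n := by
  refine (pairEx_mono P fun A B => ?_).trans (adjMean_le P n)
  split_ifs
  · exact le_rfl
  · exact binMass_one_le (jointHit_nonneg P A B) (jointHit_le_one P A B)

theorem adjProb_nonneg (n r : ℕ) : 0 ≤ adjProb P n r := by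
  refine pairEx_nonneg P fun A B => ?_
  split_ifs
  · exact le_rfl
  · exact binMass_nonneg (jointHit_nonneg P A B) (jointHit_le_one P A B)

theorem nonadjProb_nonneg (n r : ℕ) : 0 ≤ nonadjProb P n r := by
  refine pairEx_nonneg P fun A B => ?_
  split_ifs
  · exact binMass_nonneg (jointHit_nonneg P A B) (jointHit_le_one P A B)
  · exact le_rfl

theorem adjProb_le_edge (n r : ℕ) :
    adjProb P n r ≤ pairEx P (fun A B => if ¬Disjoint A B then 1 else 0) := by
  refine pairEx_mono P fun A B => ?_
  split_ifs
  · exact le_rfl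
  · exact binMass_le_one (jointHit_nonneg P A B) (jointHit_le_one P A B)

theorem adjProb_add_nonadjProb_le_one (n r : ℕ) : adjProb P n r + nonadjProb P n r ≤ 1 := by
  rw [adjProb, nonadjProb, ← pairEx_add, ← sum_wt_pair P]
  refine pairEx_mono P fun A B => ?_
  have := binMass_le_one (N := n - 2) (r := r) (jointHit_nonneg P A B) (jointHit_le_one P A B)
  by_cases h : Disjoint A B <;> simpa [h] using this

/-- A shared attribute gives the uniform bound `κ = E X / m` on `q`; the Bernoulli loss `N q`,
averaged over adjacent pairs, is at most `adjBound`. -/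
theorem le_adjProb (n r : ℕ) :
    (n - 2).choose r * (sizeEx P (fun k => k) / m) ^ r *
      (pairEx P (fun A B => if ¬Disjoint A B then 1 else 0) - adjBound P n) ≤ adjProb P n r := by
  have h2 := sizeEx_id_div_nonneg P
  calc _ ≤ (n - 2).choose r * (sizeEx P (fun k => k) / m) ^ r *
      (pairEx P (fun A B => if ¬Disjoint A B then 1 else 0) - pairEx P (fun A B =>
        if ¬Disjoint A B then ((n - 2 : ℕ) : ℝ) * jointHit P A B else 0)) := by
        gcongr
        exact adjMean_le P n
    _ ≤ _ := by
        rw [← pairEx_sub, ← pairEx_const_mul]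
        refine pairEx_mono P fun A B => ?_
        split_ifs with h
        · simp
        · exact le_binMass h2 (le_jointHit_of_not_disjoint P h) (jointHit_le_one P A B)

/-- Write `x = n ρ |A ∩ B|` and `T = n τ |A| |B|`, so that `N q ≤ x + T`. Integrating `T²` against
`|A ∩ B|` would require `E X³`. It is replaced by `T * min 1 T`, and the truncation `g` bounds the
minimum; what remains needs only `E X²` and its truncated version. -/
theorem adjProb_two_le (n : ℕ) {L : ℝ} {g : ℕ → ℝ} (hg1 : ∀ k, g k ≤ 1)
    (hgL : ∀ k, g k ≠ 0 → (k : ℝ) ≤ L) :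
    adjProb P n 2 ≤
      n ^ 2 * (sizeEx P (fun k => k) / m) ^ 2 *
        (sizeEx P (fun k => k) ^ 2 / m + (sizeEx P (fun k => k ^ 2) / m) ^ 2) / 2 +
      n ^ 2 * (sizeEx P (fun k => k) / m) * (sizeEx P (fun k => k ^ 2) / m) ^ 3 +
      n * (sizeEx P (fun k => k ^ 2) / m) ^ 3 *
        (n * (sizeEx P (fun k => k ^ 2) / m ^ 2) * L ^ 2) +
      2 * n * (sizeEx P (fun k => k ^ 2) / m) ^ 2 *
        ((sizeEx P (fun k => k ^ 2) - sizeEx P (fun k => k ^ 2 * g k)) / m) := by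
  have hτ := sizeEx_sq_div_nonneg P
  have hρ := sizeEx_id_div_nonneg P
  set τ := sizeEx P (fun k => k ^ 2) / m ^ 2 with hτ_def
  set ρ := sizeEx P (fun k => k) / m with hρ_def
  have hpt : ∀ A B : Finset (Fin m),
      (if ¬Disjoint A B then binMass (n - 2) 2 (jointHit P A B) else 0) ≤
      n ^ 2 * ρ ^ 2 / 2 * ((A ∩ B).card : ℝ) ^ 2 +
      (n ^ 2 * ρ * τ + n * τ * (n * τ * L ^ 2)) * ((A ∩ B).card * (A.card * B.card)) +
      n * τ * (((A ∩ B).card * (A.card * (1 - g A.card) * B.card)) +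
        ((A ∩ B).card * (A.card * (B.card * (1 - g B.card))))) := by
    intro A B
    have hgA := sub_nonneg.2 (hg1 A.card)
    have hgB := sub_nonneg.2 (hg1 B.card)
    split_ifs with hd
    · positivity
    · have hS := cast_one_le_card_inter hd
      have hA : (0 : ℝ) ≤ A.card := Nat.cast_nonneg _
      have hB : (0 : ℝ) ≤ B.card := Nat.cast_nonneg _
      have hq0 := jointHit_nonneg P A B
      have hq1 := jointHit_le_one P A B
      have hq := mul_jointHit_le P n A B
      rw [← hτ_def, ← hρ_def] at hq
      have hb2 := binMass_two_le (N := n - 2) hq0 hq1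
      have hb1 := binMass_le_one (N := n - 2) (r := 2) hq0 hq1
      have hNq : 0 ≤ ((n - 2 : ℕ) : ℝ) * jointHit P A B := by positivity
      set x := (n : ℝ) * ρ * (A ∩ B).card with hx
      set T := (n : ℝ) * τ * (A.card * B.card) with hT
      have hx0 : 0 ≤ x := by positivity
      have hT0 : 0 ≤ T := by positivity
      have hc0 : 0 ≤ (n : ℝ) * τ * L ^ 2 := by positivity
      -- If a truncation weight vanishes, its `1 - g` equals one and dominates the minimum.
      -- Otherwise both sizes are at most `L`, so `T ≤ n τ L²`.
      have hmin : min 1 T ≤ n * τ * L ^ 2 + (1 - g A.card) + (1 - g B.card) := by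
        by_cases hA0 : g A.card = 0
        · rw [hA0]
          exact (min_le_left _ _).trans (by linarith)
        by_cases hB0 : g B.card = 0
        · rw [hB0]
          exact (min_le_left _ _).trans (by linarith)
        have hTL : T ≤ n * τ * L ^ 2 := by
          rw [hT, sq]
          gcongr
          · exact hA.trans (hgL _ hA0)
          · exact hgL _ hA0
          · exact hgL _ hB0
        exact (min_le_right _ _).trans (by linarith)
      have hsq : (((n - 2 : ℕ) : ℝ) * jointHit P A B) ^ 2 ≤ (x + T) ^ 2 :=
        pow_le_pow_left₀ hNq hq 2
      -- For `T ≥ 1` the trivial bound `1 ≤ T` on the probability is enough; for `T ≤ 1` expand `(x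
      -- + T)² / 2`.
      have hbin : binMass (n - 2) 2 (jointHit P A B) ≤ x ^ 2 / 2 + x * T + T * min 1 T := by
        rcases le_total 1 T with h1 | h1
        · rw [min_eq_left h1]
          nlinarith [sq_nonneg x, mul_nonneg hx0 hT0]
        · rw [min_eq_right h1]
          nlinarith [sq_nonneg T]
      have hmul : T * min 1 T ≤ (A ∩ B).card *
          (T * (n * τ * L ^ 2 + (1 - g A.card) + (1 - g B.card))) := by
        have h0 : 0 ≤ T * (n * τ * L ^ 2 + (1 - g A.card) + (1 - g B.card)) := by positivity
        exact (mul_le_mul_of_nonneg_left hmin hT0).trans (le_mul_of_one_le_left h0 hS)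
      refine (hbin.trans (add_le_add_right hmul _)).trans (le_of_eq ?_)
      rw [hx, hT]
      ring
  refine (pairEx_mono P hpt).trans ?_
  rw [pairEx_add, pairEx_add, pairEx_const_mul, pairEx_const_mul, pairEx_const_mul, pairEx_add,
    pairEx_card_inter_mul_card]
  have e1 := pairEx_card_inter P (fun k => k * (1 - g k)) (fun k => k)
  have e2 := pairEx_card_inter P (fun k => k) (fun k => k * (1 - g k))
  have e3 : sizeEx P (fun k => k * (k * (1 - g k))) =
      sizeEx P (fun k => k ^ 2) - sizeEx P (fun k => k ^ 2 * g k) := by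
    rw [← sizeEx_sub]; congr 1; ext k; ring
  simp only [e3, ← sq] at e1 e2
  rw [e1, e2]
  have h4 := mul_le_mul_of_nonneg_left (pairEx_card_inter_sq_le P)
    (show 0 ≤ (n : ℝ) ^ 2 * ρ ^ 2 / 2 by positivity)
  refine (add_le_add_left (add_le_add_left h4 _) _).trans (le_of_eq ?_)
  rw [hτ_def]
  ring

theorem nonadjMean_le (n : ℕ) :
    pairEx P (fun A B => if Disjoint A B then ((n - 2 : ℕ) : ℝ) * jointHit P A B else 0) ≤
      n * (sizeEx P (fun k => k ^ 2) / m ^ 2) * sizeEx P (fun k => k) ^ 2 := by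
  rw [sq (sizeEx P _), ← pairEx_card, ← pairEx_const_mul]
  refine pairEx_mono P fun A B => ?_
  have h1 := sizeEx_sq_div_nonneg P
  split_ifs with h
  · exact mul_jointHit_le_of_disjoint P n h
  · positivity

theorem nonadjProb_one_le (n : ℕ) : nonadjProb P n 1 ≤
    n * (sizeEx P (fun k => k ^ 2) / m ^ 2) * sizeEx P (fun k => k) ^ 2 := by
  refine (pairEx_mono P fun A B => ?_).trans (nonadjMean_le P n)
  split_ifs
  · exact binMass_one_le (jointHit_nonneg P A B) (jointHit_le_one P A B)
  · exact le_rfl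

theorem nonadjSq_le (n : ℕ) :
    pairEx P (fun A B => if Disjoint A B then (((n - 2 : ℕ) : ℝ) * jointHit P A B) ^ 2 else 0) ≤
      (n * (sizeEx P (fun k => k ^ 2) / m ^ 2)) ^ 2 * sizeEx P (fun k => k ^ 2) ^ 2 := by
  rw [sq (sizeEx P _), ← pairEx_card, ← pairEx_const_mul]
  refine pairEx_mono P fun A B => ?_
  have h1 := sizeEx_sq_div_nonneg P
  split_ifs with h
  · have h0 : 0 ≤ ((n - 2 : ℕ) : ℝ) * jointHit P A B :=
      mul_nonneg (Nat.cast_nonneg _) (jointHit_nonneg P A B)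
    refine (pow_le_pow_left₀ h0 (mul_jointHit_le_of_disjoint P n h) 2).trans (le_of_eq ?_)
    ring
  · positivity

theorem nonadjProb_two_le (n : ℕ) : nonadjProb P n 2 ≤
    (n * (sizeEx P (fun k => k ^ 2) / m ^ 2)) ^ 2 * sizeEx P (fun k => k ^ 2) ^ 2 / 2 := by
  rw [div_eq_inv_mul]
  refine le_trans ?_ (mul_le_mul_of_nonneg_left (nonadjSq_le P n) (by norm_num))
  rw [← pairEx_const_mul]
  refine pairEx_mono P fun A B => ?_
  split_ifs
  · have := binMass_two_le (N := n - 2) (jointHit_nonneg P A B) (jointHit_le_one P A B)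
    rwa [← div_eq_inv_mul]
  · simp

theorem nonadjProb_le_sq (n : ℕ) {r : ℕ} (hr : 2 ≤ r) : nonadjProb P n r ≤
    (n * (sizeEx P (fun k => k ^ 2) / m ^ 2)) ^ 2 * sizeEx P (fun k => k ^ 2) ^ 2 := by
  refine le_trans ?_ (nonadjSq_le P n)
  refine pairEx_mono P fun A B => ?_
  split_ifs
  · exact binMass_le_sq (jointHit_nonneg P A B) (jointHit_le_one P A B) hr
  · exact le_rfl

/-- Given the pair, the probability of no common neighbour is at least `1 - N q`; average this over
adjacent and disjoint pairs separately. -/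
theorem le_adjProb_zero_add_nonadjProb_zero (n : ℕ) :
    1 - adjBound P n - n * (sizeEx P (fun k => k ^ 2) / m ^ 2) * sizeEx P (fun k => k) ^ 2 ≤
      adjProb P n 0 + nonadjProb P n 0 := by
  have h1 := adjMean_le P n
  have h2 := nonadjMean_le P n
  have h : pairEx P (fun _ _ => 1) -
      (pairEx P (fun A B => if ¬Disjoint A B then ((n - 2 : ℕ) : ℝ) * jointHit P A B else 0) +
      pairEx P (fun A B => if Disjoint A B then ((n - 2 : ℕ) : ℝ) * jointHit P A B else 0)) ≤
      adjProb P n 0 + nonadjProb P n 0 := by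
    rw [adjProb, nonadjProb, ← pairEx_add, ← pairEx_add, ← pairEx_sub]
    refine pairEx_mono P fun A B => ?_
    have := le_binMass (N := n - 2) (r := 0) (jointHit_nonneg P A B) le_rfl (jointHit_le_one P A B)
    rw [Nat.choose_zero_right, pow_zero, Nat.cast_one, one_mul, one_mul] at this
    by_cases hd : Disjoint A B <;> simpa [hd] using this
  rw [sum_wt_pair] at h
  linarith

/-- Restrict to truncated sizes by the weights `g`. There `q ≥ |A| |B| κ`, and `N q` is uniformly at
most `n τ L²`. Disjointness is enforced by the factor `1 - |A ∩ B|`, which is at most its indicator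
and whose expectation factorises. -/
theorem le_nonadjProb (n r : ℕ) {L κ : ℝ} {g : ℕ → ℝ} (hg : ∀ k, 0 ≤ g k) (hg1 : ∀ k, g k ≤ 1)
    (hL : 0 ≤ L) (hgL : ∀ k, g k ≠ 0 → (k : ℝ) ≤ L) (hκ : 0 ≤ κ)
    (hκ_le : κ ≤ sizeEx P (fun k => k * (k - 1) * g k) / (m * (m - 1)) -
      2 * L * (sizeEx P (fun k => k ^ 3 * g k) / m ^ 3))
    (hc : n * (sizeEx P (fun k => k ^ 2) / m ^ 2) * L ^ 2 ≤ 1) :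
    (n - 2).choose r * κ ^ r * (1 - n * (sizeEx P (fun k => k ^ 2) / m ^ 2) * L ^ 2) *
      ((1 - L ^ 2 / m) * sizeEx P (fun k => k ^ r * g k) ^ 2) ≤ nonadjProb P n r := by
  have hτ := sizeEx_sq_div_nonneg P
  set τ := sizeEx P (fun k => k ^ 2) / m ^ 2 with hτ_def
  have hc0 : 0 ≤ 1 - n * τ * L ^ 2 := sub_nonneg.2 hc
  have hpt : ∀ A B : Finset (Fin m),
      (n - 2).choose r * κ ^ r * (1 - n * τ * L ^ 2) *
        ((A.card ^ r * g A.card * (B.card ^ r * g B.card)) -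
          (A ∩ B).card * (A.card ^ r * g A.card * (B.card ^ r * g B.card))) ≤
      if Disjoint A B then binMass (n - 2) r (jointHit P A B) else 0 := by
    intro A B
    have hgA := hg A.card
    have hgB := hg B.card
    split_ifs with hd
    · have hq0 := jointHit_nonneg P A B
      have hq1 := jointHit_le_one P A B
      have hb0 := binMass_nonneg (N := n - 2) (r := r) hq0 hq1
      rw [card_inter_eq_zero hd, Nat.cast_zero, zero_mul, sub_zero]
      by_cases hA0 : g A.card = 0
      · simpa [hA0] using hb0
      by_cases hB0 : g B.card = 0
      · simpa [hB0] using hb0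
      have hA : (0 : ℝ) ≤ A.card := Nat.cast_nonneg _
      have hB : (0 : ℝ) ≤ B.card := Nat.cast_nonneg _
      have hAL := hgL _ hA0
      have hBL := hgL _ hB0
      have hκq : A.card * B.card * κ ≤ jointHit P A B :=
        (mul_le_mul_of_nonneg_left hκ_le (by positivity)).trans
          (le_jointHit_of_disjoint P hd hAL hBL hg hg1)
      have hb := le_binMass (N := n - 2) (r := r) (by positivity) hκq hq1
      have hq : ((n - 2 : ℕ) : ℝ) * jointHit P A B ≤ n * τ * L ^ 2 := by
        refine (mul_jointHit_le_of_disjoint P n hd).trans ?_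
        rw [sq L]
        gcongr
      have hgg : g A.card * g B.card ≤ 1 := mul_le_one₀ (hg1 _) hgB (hg1 _)
      calc (n - 2).choose r * κ ^ r * (1 - n * τ * L ^ 2) *
            (A.card ^ r * g A.card * (B.card ^ r * g B.card))
          = ((n - 2).choose r * (A.card * B.card * κ) ^ r * (1 - n * τ * L ^ 2)) *
            (g A.card * g B.card) := by ring
        _ ≤ (n - 2).choose r * (A.card * B.card * κ) ^ r * (1 - n * τ * L ^ 2) :=
            mul_le_of_le_one_right (by positivity) hgg
        _ ≤ (n - 2).choose r * (A.card * B.card * κ) ^ r *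
            (1 - ((n - 2 : ℕ) : ℝ) * jointHit P A B) := by
            gcongr
        _ ≤ _ := hb
    · have hS := cast_one_le_card_inter hd
      refine mul_nonpos_of_nonneg_of_nonpos (by positivity) (sub_nonpos.2 ?_)
      exact le_mul_of_one_le_left (by positivity) hS
  refine le_trans ?_ (pairEx_mono P hpt)
  rw [pairEx_const_mul, pairEx_sub]
  have e1 := pairEx_card P (fun k => k ^ r * g k) (fun k => k ^ r * g k)
  have e2 := pairEx_card_inter P (fun k => k ^ r * g k) (fun k => k ^ r * g k)
  rw [e1, e2]
  refine mul_le_mul_of_nonneg_left ?_ (by positivity)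
  -- On the support of `g` one has `k ≤ L`, so the extra factor `k` from the intersection costs only
  -- `L`. This is the origin of `1 - L² / m`.
  have h3 : sizeEx P (fun k => k * (k ^ r * g k)) ≤ L * sizeEx P (fun k => k ^ r * g k) := by
    rw [← sizeEx_const_mul]
    refine sizeEx_mono P fun k _ => ?_
    by_cases hk : g k = 0
    · simp [hk]
    · have := hg k
      exact mul_le_mul_of_nonneg_right (hgL k hk) (by positivity)
  have h4 : 0 ≤ sizeEx P (fun k => k * (k ^ r * g k)) := sizeEx_nonneg P fun k => by
    have := hg k
    positivity
  have h5 : sizeEx P (fun k => k * (k ^ r * g k)) * sizeEx P (fun k => k * (k ^ r * g k)) / m ≤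
      (L * sizeEx P (fun k => k ^ r * g k)) * (L * sizeEx P (fun k => k ^ r * g k)) / m :=
    div_le_div_of_nonneg_right (mul_le_mul h3 h3 h4 (h4.trans h3)) (Nat.cast_nonneg _)
  refine le_trans (le_of_eq ?_) (sub_le_sub_left h5 _)
  ring

end

/-! ### The same bounds in the scaling `m = t² n`, `E X = M₁ t`, `E X² = M₂ t²` -/

section

variable {m n : ℕ} (P : PMF (Fin (m + 1))) {t M₁ M₂ : ℝ}

theorem edge_le_scaled (hn : 0 < n) (ht : 0 < t) (hm : (m : ℝ) = t ^ 2 * n)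
    (h1 : sizeEx P (fun k => k) = M₁ * t) :
    n * pairEx P (fun A B => if ¬Disjoint A B then 1 else 0) ≤ M₁ ^ 2 := by
  have hn' : (0 : ℝ) < n := by exact_mod_cast hn
  have h := mul_le_mul_of_nonneg_left (edge_le P) hn'.le
  rw [h1, hm] at h
  refine h.trans (le_of_eq ?_)
  field_simp

theorem le_edge_scaled (hn : 0 < n) (ht : 0 < t) (hm : (m : ℝ) = t ^ 2 * n)
    (h1 : sizeEx P (fun k => k) = M₁ * t) (h2 : sizeEx P (fun k => k ^ 2) = M₂ * t ^ 2) :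
    M₁ ^ 2 - M₂ ^ 2 / n ≤ n * pairEx P (fun A B => if ¬Disjoint A B then 1 else 0) := by
  have hn' : (0 : ℝ) < n := by exact_mod_cast hn
  have h := mul_le_mul_of_nonneg_left (le_edge P) hn'.le
  rw [h1, h2, hm] at h
  refine le_trans (le_of_eq ?_) h
  field_simp

theorem adjBound_scaled (hn : 0 < n) (ht : 0 < t) (hm : (m : ℝ) = t ^ 2 * n)
    (h1 : sizeEx P (fun k => k) = M₁ * t) (h2 : sizeEx P (fun k => k ^ 2) = M₂ * t ^ 2) :
    n * adjBound P n = M₁ ^ 3 / t + M₂ ^ 3 / n := by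
  have hn' : (0 : ℝ) < n := by exact_mod_cast hn
  rw [adjBound, h1, h2, hm]
  field_simp

theorem le_adjProb_scaled (hn : 0 < n) (ht : 0 < t) (hm : (m : ℝ) = t ^ 2 * n)
    (h1 : sizeEx P (fun k => k) = M₁ * t) (r : ℕ) :
    (n - 2).choose r / n ^ r * M₁ ^ r *
      (n * pairEx P (fun A B => if ¬Disjoint A B then 1 else 0) - n * adjBound P n) ≤
    n * t ^ r * adjProb P n r := by
  have hn' : (0 : ℝ) < n := by exact_mod_cast hn
  have h := mul_le_mul_of_nonneg_left (le_adjProb P n r) (show 0 ≤ n * t ^ r by positivity)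
  rw [h1, hm] at h
  refine le_trans (le_of_eq ?_) h
  rw [show M₁ * t / (t ^ 2 * n) = M₁ / (t * n) by field_simp, div_pow, mul_pow]
  field_simp

theorem adjProb_two_le_scaled (hn : 0 < n) (ht : 0 < t) (hm : (m : ℝ) = t ^ 2 * n)
    (h1 : sizeEx P (fun k => k) = M₁ * t) (h2 : sizeEx P (fun k => k ^ 2) = M₂ * t ^ 2)
    {K G₂ : ℝ} {g : ℕ → ℝ} (hg1 : ∀ k, g k ≤ 1)
    (hgL : ∀ k, g k ≠ 0 → (k : ℝ) ≤ K * t)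
    (hG2 : sizeEx P (fun k => k ^ 2 * g k) = G₂ * t ^ 2) :
    n ^ 2 * adjProb P n 2 ≤ n / t ^ 2 * (M₁ ^ 4 / 2) + M₁ ^ 2 * M₂ ^ 2 / (2 * t ^ 2) +
      M₁ * M₂ ^ 3 / t + K ^ 2 * M₂ ^ 4 / n + 2 * M₂ ^ 2 * (M₂ - G₂) := by
  have hn' : (0 : ℝ) < n := by exact_mod_cast hn
  have h := mul_le_mul_of_nonneg_left (adjProb_two_le P n hg1 hgL)
    (show (0 : ℝ) ≤ n ^ 2 by positivity)
  rw [h1, h2, hG2, hm] at h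
  refine h.trans (le_of_eq ?_)
  field_simp

theorem nonadjProb_one_le_scaled (hn : 0 < n) (ht : 0 < t) (hm : (m : ℝ) = t ^ 2 * n)
    (h1 : sizeEx P (fun k => k) = M₁ * t) (h2 : sizeEx P (fun k => k ^ 2) = M₂ * t ^ 2) :
    n * nonadjProb P n 1 ≤ M₁ ^ 2 * M₂ := by
  have hn' : (0 : ℝ) < n := by exact_mod_cast hn
  have h := mul_le_mul_of_nonneg_left (nonadjProb_one_le P n) hn'.le
  rw [h1, h2, hm] at h
  refine h.trans (le_of_eq ?_)
  field_simp

theorem nonadjProb_two_le_scaled (hn : 0 < n) (ht : 0 < t) (hm : (m : ℝ) = t ^ 2 * n)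
    (h2 : sizeEx P (fun k => k ^ 2) = M₂ * t ^ 2) :
    n ^ 2 * nonadjProb P n 2 ≤ M₂ ^ 4 / 2 := by
  have hn' : (0 : ℝ) < n := by exact_mod_cast hn
  have h := mul_le_mul_of_nonneg_left (nonadjProb_two_le P n) (show (0 : ℝ) ≤ n ^ 2 by positivity)
  rw [h2, hm] at h
  refine h.trans (le_of_eq ?_)
  field_simp

theorem nonadjProb_le_scaled (hn : 0 < n) (ht : 0 < t) (hm : (m : ℝ) = t ^ 2 * n)
    (h2 : sizeEx P (fun k => k ^ 2) = M₂ * t ^ 2) {r : ℕ} (hr : 2 ≤ r) :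
    n * t ^ r * nonadjProb P n r ≤ t ^ r / n * M₂ ^ 4 := by
  have hn' : (0 : ℝ) < n := by exact_mod_cast hn
  have h := mul_le_mul_of_nonneg_left (nonadjProb_le_sq P n hr)
    (show (0 : ℝ) ≤ n * t ^ r by positivity)
  rw [h2, hm] at h
  refine h.trans (le_of_eq ?_)
  field_simp

theorem le_common_zero_scaled (hn : 0 < n) (ht : 0 < t) (hm : (m : ℝ) = t ^ 2 * n)
    (h1 : sizeEx P (fun k => k) = M₁ * t) (h2 : sizeEx P (fun k => k ^ 2) = M₂ * t ^ 2) :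
    1 - adjBound P n - M₁ ^ 2 * M₂ / n ≤ adjProb P n 0 + nonadjProb P n 0 := by
  have hn' : (0 : ℝ) < n := by exact_mod_cast hn
  have h := le_adjProb_zero_add_nonadjProb_zero P n
  rw [h1, h2, hm] at h
  refine le_trans (le_of_eq ?_) h
  congr 1
  field_simp

theorem le_nonadjProb_scaled (hn : 0 < n) (ht : 0 < t) (hm : (m : ℝ) = t ^ 2 * n) (hm2 : 2 ≤ m)
    (h2 : sizeEx P (fun k => k ^ 2) = M₂ * t ^ 2)
    {K G₁ G₂ : ℝ} (hK : 0 ≤ K) {g : ℕ → ℝ} (hg : ∀ k, 0 ≤ g k) (hg1 : ∀ k, g k ≤ 1)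
    (hgL : ∀ k, g k ≠ 0 → (k : ℝ) ≤ K * t)
    (hG1 : sizeEx P (fun k => k * g k) = G₁ * t)
    (hG2 : sizeEx P (fun k => k ^ 2 * g k) = G₂ * t ^ 2)
    (hκ : 0 ≤ G₂ - G₁ / t - 2 * K ^ 2 * M₂ / n) (hc : K ^ 2 * M₂ / n ≤ 1) {r : ℕ} {G : ℝ}
    (hG : sizeEx P (fun k => k ^ r * g k) = G * t ^ r) :
    (n - 2).choose r / n ^ r * (G₂ - G₁ / t - 2 * K ^ 2 * M₂ / n) ^ r *
      (1 - K ^ 2 * M₂ / n) * ((1 - K ^ 2 / n) * G ^ 2) ≤ n ^ r * nonadjProb P n r := by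
  have hn' : (0 : ℝ) < n := by exact_mod_cast hn
  have hm' : (2 : ℝ) ≤ m := by exact_mod_cast hm2
  have hm0 : (0 : ℝ) < m := by linarith
  have hcut : n * (sizeEx P (fun k => k ^ 2) / m ^ 2) * (K * t) ^ 2 = K ^ 2 * M₂ / n := by
    rw [h2, hm]; field_simp
  have hL : (0 : ℝ) ≤ K * t := by positivity
  have e1 : sizeEx P (fun k => k * (k - 1) * g k) = G₂ * t ^ 2 - G₁ * t := by
    rw [← hG1, ← hG2, ← sizeEx_sub]; congr 1; ext k; ring
  have e1_nonneg : 0 ≤ sizeEx P (fun k => k * (k - 1) * g k) := by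
    refine sizeEx_nonneg P fun k => mul_nonneg ?_ (hg k)
    rcases Nat.eq_zero_or_pos k with rfl | hk
    · simp
    · exact mul_nonneg (Nat.cast_nonneg _) (sub_nonneg.2 (by exact_mod_cast hk))
  have e2 : sizeEx P (fun k => k ^ 3 * g k) ≤ K * t * (M₂ * t ^ 2) := by
    rw [← h2, ← sizeEx_const_mul]
    refine sizeEx_mono P fun k _ => ?_
    -- The truncated third moment is at most the truncation level `K t` times the full second
    -- moment.
    by_cases hk : g k = 0
    · rw [hk, mul_zero]; positivity
    · calc (k : ℝ) ^ 3 * g k ≤ k ^ 3 * 1 := by gcongr; exact hg1 k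
        _ = (k : ℝ) * (k : ℝ) ^ 2 := by ring
        _ ≤ K * t * (k : ℝ) ^ 2 := by gcongr; exact hgL k hk
  -- The denominator `m (m - 1)` is enlarged to `m²`, which is legitimate since the numerator is
  -- nonnegative. With `m = t² n`, the factor `1 / (n m)` then comes out of every term.
  have hκ_le : (G₂ - G₁ / t - 2 * K ^ 2 * M₂ / n) / (n * m) ≤
      sizeEx P (fun k => k * (k - 1) * g k) / (m * (m - 1)) -
      2 * (K * t) * (sizeEx P (fun k => k ^ 3 * g k) / m ^ 3) := by
    have e3 : (G₂ * t ^ 2 - G₁ * t) / (m * m) ≤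
        sizeEx P (fun k => k * (k - 1) * g k) / (m * (m - 1)) := by
      rw [← e1]
      have hm1 : (0 : ℝ) < m - 1 := by linarith
      refine div_le_div_of_nonneg_left e1_nonneg (by positivity) ?_
      gcongr
      linarith
    have e4 : 2 * (K * t) * (sizeEx P (fun k => k ^ 3 * g k) / m ^ 3) ≤
        2 * (K * t) * (K * t * (M₂ * t ^ 2) / m ^ 3) := by gcongr
    refine le_trans (le_of_eq ?_) (sub_le_sub e3 e4)
    rw [hm]
    field_simp
  have h := mul_le_mul_of_nonneg_left
    (le_nonadjProb P n r hg hg1 hL hgL (by positivity) hκ_le (hcut.trans_le hc))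
    (show (0 : ℝ) ≤ n ^ r by positivity)
  refine le_trans (le_of_eq ?_) h
  rw [hcut, hG, hm, div_pow, mul_pow (n : ℝ), mul_pow (t ^ 2), ← pow_mul t,
    show (K * t) ^ 2 / (t ^ 2 * n) = K ^ 2 / n by field_simp, mul_pow G, ← pow_mul t, mul_comm r 2]
  field_simp

end

/-! ### Limit tools, the cutoff and the limiting moments -/

/-- Squeezing with an auxiliary truncation level: for a fixed large `K` the bounds converge in `n`,
and their limits come together as `K → ∞`. -/
theorem tendsto_of_families {x : ℕ → ℝ} {l u : ℕ → ℕ → ℝ} {l' u' : ℕ → ℝ} {a : ℝ}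
    (hl : ∀ᶠ K in atTop, Tendsto (l K) atTop (𝓝 (l' K))) (hl' : Tendsto l' atTop (𝓝 a))
    (hlx : ∀ᶠ K in atTop, ∀ᶠ n in atTop, l K n ≤ x n)
    (hu : ∀ᶠ K in atTop, Tendsto (u K) atTop (𝓝 (u' K))) (hu' : Tendsto u' atTop (𝓝 a))
    (hxu : ∀ᶠ K in atTop, ∀ᶠ n in atTop, x n ≤ u K n) : Tendsto x atTop (𝓝 a) := by
  refine tendsto_order.2 ⟨fun b hb => ?_, fun b hb => ?_⟩
  · obtain ⟨K, h1, h2, h3⟩ := (hl.and (hlx.and (hl'.eventually (lt_mem_nhds hb)))).exists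
    filter_upwards [h2, h1.eventually (lt_mem_nhds h3)] with n hn hn'
    exact hn'.trans_le hn
  · obtain ⟨K, h1, h2, h3⟩ := (hu.and (hxu.and (hu'.eventually (gt_mem_nhds hb)))).exists
    filter_upwards [h2, h1.eventually (gt_mem_nhds h3)] with n hn hn'
    exact hn.trans_lt hn'

/-- If `a` dominates `e` after a common rescaling, then `a / (a + e)` tends to one. -/
theorem tendsto_ratio_one {a e s l v : ℕ → ℝ} {c : ℝ} (hc : 0 < c) (hs : ∀ᶠ n in atTop, 0 < s n)
    (he : ∀ n, 0 ≤ e n) (hl : Tendsto l atTop (𝓝 c))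
    (hla : ∀ᶠ n in atTop, l n ≤ s n * a n) (hv : Tendsto v atTop (𝓝 0))
    (hev : ∀ᶠ n in atTop, s n * e n ≤ v n) :
    (∀ᶠ n in atTop, 0 < a n + e n) ∧ Tendsto (fun n => a n / (a n + e n)) atTop (𝓝 1) := by
  have hpos : ∀ᶠ n in atTop, 0 < a n := by
    filter_upwards [hs, hla, hl.eventually (lt_mem_nhds hc)] with n h1 h2 h3
    exact pos_of_mul_pos_right (h3.trans_le h2) h1.le
  refine ⟨hpos.mono fun n hn => add_pos_of_pos_of_nonneg hn (he n), ?_⟩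
  have h0 : Tendsto (fun n => 1 - v n / l n) atTop (𝓝 1) := by
    simpa using (tendsto_const_nhds (x := (1 : ℝ))).sub (hv.div hl hc.ne')
  refine tendsto_of_tendsto_of_tendsto_of_le_of_le' h0 tendsto_const_nhds ?_ ?_
  · filter_upwards [hs, hla, hl.eventually (lt_mem_nhds hc), hev, hpos] with n h1 h2 h3 h4 h5
    have h6 : e n / a n ≤ v n / l n := by
      rw [← mul_div_mul_left _ _ h1.ne']
      exact div_le_div₀ ((mul_nonneg h1.le (he n)).trans h4) h4 h3 h2
    have h7 : 1 - e n / a n ≤ a n / (a n + e n) := by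
      have h8 : 0 < a n + e n := add_pos_of_pos_of_nonneg h5 (he n)
      rw [le_div_iff₀ h8, sub_mul, div_mul_eq_mul_div, sub_le_iff_le_add, one_mul]
      have : e n ≤ e n * (a n + e n) / a n := by
        rw [le_div_iff₀ h5]
        nlinarith [he n, mul_nonneg (he n) (he n)]
      linarith
    linarith
  · filter_upwards [hpos] with n h5
    have h8 : 0 < a n + e n := add_pos_of_pos_of_nonneg h5 (he n)
    rw [div_le_one h8]
    linarith [he n]

theorem tendsto_choose_sub_two_div_pow (r : ℕ) :
    Tendsto (fun n : ℕ => ((n - 2).choose r : ℝ) / n ^ r) atTop (𝓝 (r.factorial : ℝ)⁻¹) := by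
  have hd : Tendsto (fun n : ℕ => ((n - 2).descFactorial r : ℝ) / n ^ r) atTop (𝓝 1) := by
    induction r with
    | zero => simp
    | succ r ih =>
      have h1 : Tendsto (fun n : ℕ => ((n - 2 - r : ℕ) : ℝ) / n) atTop (𝓝 1) := by
        have h2 : Tendsto (fun n : ℕ => 1 - ((2 + r : ℕ) : ℝ) / n) atTop (𝓝 1) := by
          simpa using (tendsto_const_nhds (x := (1 : ℝ))).sub
            (tendsto_const_div_atTop_nhds_zero_nat ((2 + r : ℕ) : ℝ))
        refine h2.congr' ?_
        filter_upwards [eventually_ge_atTop (2 + r + 1)] with n hn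
        have hn' : (n : ℝ) ≠ 0 := by exact_mod_cast (by omega : n ≠ 0)
        rw [Nat.sub_sub, Nat.cast_sub (by omega), sub_div, div_self hn']
      have h3 := h1.mul ih
      rw [one_mul] at h3
      refine h3.congr fun n => ?_
      rw [Nat.descFactorial_succ, Nat.cast_mul, pow_succ', mul_div_mul_comm]
  have h := hd.const_mul (r.factorial : ℝ)⁻¹
  rw [mul_one] at h
  refine h.congr fun n => ?_
  have h0 : (r.factorial : ℝ) ≠ 0 := by exact_mod_cast r.factorial_ne_zero
  rw [Nat.descFactorial_eq_factorial_mul_choose, Nat.cast_mul]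
  field_simp

/-- The piecewise linear cutoff which is one for `|y| ≤ K - 1` and zero for `|y| ≥ K`. -/
def cutoff (K : ℕ) (y : ℝ) : ℝ := max 0 (min 1 (K - |y|))

/-- The limits of the moments and of the truncated moments of the rescaled sizes. -/
structure MomentLimits (m : ℕ → ℕ) (P : (n : ℕ) → PMF (Fin (m n + 1))) (t M₁ M₂ : ℕ → ℝ)
    (z₁ z₂ : ℝ) (G₁ G₂ : ℕ → ℕ → ℝ) (g₁ g₂ : ℕ → ℝ) : Prop where
  scale : Tendsto t atTop atTop
  size : ∀ᶠ n in atTop, (m n : ℝ) = t n ^ 2 * n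
  one_eq : ∀ᶠ n in atTop, sizeEx (P n) (fun k => k) = M₁ n * t n
  two_eq : ∀ᶠ n in atTop, sizeEx (P n) (fun k => k ^ 2) = M₂ n * t n ^ 2
  cut_one_eq : ∀ K, ∀ᶠ n in atTop,
    sizeEx (P n) (fun k => k * cutoff K (k / t n)) = G₁ K n * t n
  cut_two_eq : ∀ K, ∀ᶠ n in atTop,
    sizeEx (P n) (fun k => k ^ 2 * cutoff K (k / t n)) = G₂ K n * t n ^ 2
  one : Tendsto M₁ atTop (𝓝 z₁)
  two : Tendsto M₂ atTop (𝓝 z₂)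
  cut_one : ∀ K, Tendsto (G₁ K) atTop (𝓝 (g₁ K))
  cut_two : ∀ K, Tendsto (G₂ K) atTop (𝓝 (g₂ K))
  lim_one : Tendsto g₁ atTop (𝓝 z₁)
  lim_two : Tendsto g₂ atTop (𝓝 z₂)
  pos_one : 0 < z₁
  pos_two : 0 < z₂

theorem cutoff_nonneg (K : ℕ) (y : ℝ) : 0 ≤ cutoff K y := le_max_left _ _

theorem cutoff_le_one (K : ℕ) (y : ℝ) : cutoff K y ≤ 1 := max_le zero_le_one (min_le_left _ _)

theorem abs_le_of_cutoff_ne_zero {K : ℕ} {y : ℝ} (h : cutoff K y ≠ 0) : |y| ≤ K := by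
  by_contra! hlt
  exact h (max_eq_left ((min_le_right _ _).trans (sub_nonpos.2 hlt.le)))

/-! ### Asymptotics of the joint probabilities and of `cl` -/

namespace MomentLimits

variable {m : ℕ → ℕ} {P : (n : ℕ) → PMF (Fin (m n + 1))} {t M₁ M₂ : ℕ → ℝ}
  {z₁ z₂ : ℝ} {G₁ G₂ : ℕ → ℕ → ℝ} {g₁ g₂ : ℕ → ℝ}

theorem eventually_cutoff (H : MomentLimits m P t M₁ M₂ z₁ z₂ G₁ G₂ g₁ g₂) (K : ℕ) :
    ∀ᶠ n in atTop, ∀ k : ℕ, cutoff K (k / t n) ≠ 0 → (k : ℝ) ≤ K * t n := by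
  filter_upwards [H.scale.eventually_gt_atTop 0] with n hn k hk
  have := abs_le_of_cutoff_ne_zero hk
  rwa [abs_of_nonneg (by positivity), div_le_iff₀ hn] at this

theorem tendsto_edge (H : MomentLimits m P t M₁ M₂ z₁ z₂ G₁ G₂ g₁ g₂) :
    Tendsto (fun n : ℕ => n * pairEx (P n) (fun A B => if ¬Disjoint A B then 1 else 0)) atTop
      (𝓝 (z₁ ^ 2)) := by
  have hl : Tendsto (fun n => M₁ n ^ 2 - M₂ n ^ 2 / n) atTop (𝓝 (z₁ ^ 2)) := by
    simpa using (H.one.pow 2).sub ((H.two.pow 2).div_atTop tendsto_natCast_atTop_atTop)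
  refine tendsto_of_tendsto_of_tendsto_of_le_of_le' hl (H.one.pow 2) ?_ ?_
  · filter_upwards [H.size, H.one_eq, H.two_eq, H.scale.eventually_gt_atTop 0,
      eventually_gt_atTop 0] with n hm h1 h2 ht hn
    exact le_edge_scaled (P n) hn ht hm h1 h2
  · filter_upwards [H.size, H.one_eq, H.scale.eventually_gt_atTop 0,
      eventually_gt_atTop 0] with n hm h1 ht hn
    exact edge_le_scaled (P n) hn ht hm h1

theorem tendsto_adjBound (H : MomentLimits m P t M₁ M₂ z₁ z₂ G₁ G₂ g₁ g₂) :
    Tendsto (fun n : ℕ => n * adjBound (P n) n) atTop (𝓝 0) := by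
  have h : Tendsto (fun n => M₁ n ^ 3 / t n + M₂ n ^ 3 / n) atTop (𝓝 0) := by
    simpa using ((H.one.pow 3).div_atTop H.scale).add
      ((H.two.pow 3).div_atTop tendsto_natCast_atTop_atTop)
  refine h.congr' ?_
  filter_upwards [H.size, H.one_eq, H.two_eq, H.scale.eventually_gt_atTop 0,
      eventually_gt_atTop 0] with n hm h1 h2 ht hn
  exact (adjBound_scaled (P n) hn ht hm h1 h2).symm

/-- The lower bound for `n * t ^ r * adjProb` and its limit. -/
theorem exists_le_adjProb (H : MomentLimits m P t M₁ M₂ z₁ z₂ G₁ G₂ g₁ g₂) (r : ℕ) :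
    ∃ l : ℕ → ℝ, Tendsto l atTop (𝓝 ((r.factorial : ℝ)⁻¹ * z₁ ^ (r + 2))) ∧
      ∀ᶠ n : ℕ in atTop, l n ≤ n * t n ^ r * adjProb (P n) n r := by
  refine ⟨fun n => (n - 2).choose r / n ^ r * M₁ n ^ r *
    (n * pairEx (P n) (fun A B => if ¬Disjoint A B then 1 else 0) - n * adjBound (P n) n), ?_, ?_⟩
  rotate_left
  · filter_upwards [H.size, H.one_eq, H.scale.eventually_gt_atTop 0,
      eventually_gt_atTop 0] with n hm h1 ht hn
    exact le_adjProb_scaled (P n) hn ht hm h1 r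
  · have h := ((tendsto_choose_sub_two_div_pow r).mul (H.one.pow r)).mul
      (H.tendsto_edge.sub H.tendsto_adjBound)
    refine h.trans (le_of_eq ?_)
    congr 1
    ring

theorem tendsto_adjProb_one (H : MomentLimits m P t M₁ M₂ z₁ z₂ G₁ G₂ g₁ g₂) :
    Tendsto (fun n : ℕ => n * adjProb (P n) n 1) atTop (𝓝 0) :=
  tendsto_of_tendsto_of_tendsto_of_le_of_le tendsto_const_nhds H.tendsto_adjBound
    (fun n => mul_nonneg (Nat.cast_nonneg n) (adjProb_nonneg (P n) n 1))
    (fun n => mul_le_mul_of_nonneg_left (adjProb_one_le (P n) n) (Nat.cast_nonneg n))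

theorem adjProb_one_upper (H : MomentLimits m P t M₁ M₂ z₁ z₂ G₁ G₂ g₁ g₂) :
    ∀ᶠ n : ℕ in atTop, n * adjProb (P n) n 1 ≤ M₁ n ^ 3 / t n + M₂ n ^ 3 / n := by
  filter_upwards [H.size, H.one_eq, H.two_eq, H.scale.eventually_gt_atTop 0,
      eventually_gt_atTop 0] with n hm h1 h2 ht hn
  rw [← adjBound_scaled (P n) hn ht hm h1 h2]
  exact mul_le_mul_of_nonneg_left (adjProb_one_le (P n) n) (Nat.cast_nonneg n)

theorem two_le_size (H : MomentLimits m P t M₁ M₂ z₁ z₂ G₁ G₂ g₁ g₂) :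
    ∀ᶠ n in atTop, 2 ≤ m n := by
  filter_upwards [H.size, H.scale.eventually_ge_atTop 1, eventually_ge_atTop 2] with n hm ht hn
  have hn' : (2 : ℝ) ≤ n := by exact_mod_cast hn
  have : (2 : ℝ) ≤ m n := by rw [hm]; nlinarith
  exact_mod_cast this

theorem tendsto_cut (H : MomentLimits m P t M₁ M₂ z₁ z₂ G₁ G₂ g₁ g₂) (K : ℕ) :
    Tendsto (fun n : ℕ => G₂ K n - G₁ K n / t n - 2 * (K : ℝ) ^ 2 * M₂ n / n) atTop
      (𝓝 (g₂ K)) := by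
  simpa using ((H.cut_two K).sub ((H.cut_one K).div_atTop H.scale)).sub
    ((H.two.const_mul (2 * (K : ℝ) ^ 2)).div_atTop tendsto_natCast_atTop_atTop)

/-- The upper bound is left as a hypothesis because for `r = 1, 2` it follows from untruncated
moments. Truncation is needed only from below, and `z` stands for the limiting `r`-th moment. -/
theorem tendsto_nonadjProb (H : MomentLimits m P t M₁ M₂ z₁ z₂ G₁ G₂ g₁ g₂) {r : ℕ}
    {G : ℕ → ℕ → ℝ} {g : ℕ → ℝ} {z : ℝ} {u : ℕ → ℝ}
    (hG : ∀ K, ∀ᶠ n in atTop,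
      sizeEx (P n) (fun k => k ^ r * cutoff K (k / t n)) = G K n * t n ^ r)
    (hGg : ∀ K, Tendsto (G K) atTop (𝓝 (g K))) (hg : Tendsto g atTop (𝓝 z))
    (hu : Tendsto u atTop (𝓝 ((r.factorial : ℝ)⁻¹ * z₂ ^ r * z ^ 2)))
    (hle : ∀ᶠ n : ℕ in atTop, n ^ r * nonadjProb (P n) n r ≤ u n) :
    Tendsto (fun n : ℕ => n ^ r * nonadjProb (P n) n r) atTop
      (𝓝 ((r.factorial : ℝ)⁻¹ * z₂ ^ r * z ^ 2)) := by
  refine tendsto_of_families (l := fun K n => ((n - 2).choose r : ℝ) / n ^ r *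
    (G₂ K n - G₁ K n / t n - 2 * (K : ℝ) ^ 2 * M₂ n / n) ^ r *
      (1 - (K : ℝ) ^ 2 * M₂ n / n) * ((1 - (K : ℝ) ^ 2 / n) * G K n ^ 2))
    (l' := fun K => (r.factorial : ℝ)⁻¹ * g₂ K ^ r * g K ^ 2)
    (u := fun _ => u) (u' := fun _ => (r.factorial : ℝ)⁻¹ * z₂ ^ r * z ^ 2)
    (Eventually.of_forall fun K => ?_)
    (((H.lim_two.pow r).const_mul _).mul (hg.pow 2)) ?_ (Eventually.of_forall fun _ => hu)
    tendsto_const_nhds (Eventually.of_forall fun _ => hle)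
  · have e1 : Tendsto (fun n : ℕ => 1 - (K : ℝ) ^ 2 * M₂ n / n) atTop (𝓝 1) := by
      simpa using (tendsto_const_nhds (x := (1 : ℝ))).sub
        ((H.two.const_mul ((K : ℝ) ^ 2)).div_atTop tendsto_natCast_atTop_atTop)
    have e2 : Tendsto (fun n : ℕ => 1 - (K : ℝ) ^ 2 / n) atTop (𝓝 1) := by
      simpa using (tendsto_const_nhds (x := (1 : ℝ))).sub
        (tendsto_const_div_atTop_nhds_zero_nat ((K : ℝ) ^ 2))
    have h := (((tendsto_choose_sub_two_div_pow r).mul ((H.tendsto_cut K).pow r)).mul e1).mul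
      (e2.mul ((hGg K).pow 2))
    simpa using h
  -- For large `K` the limit `g₂ K` is positive, hence the lower bound `κ` on `q` is eventually
  -- nonnegative, as its powers require.
  · filter_upwards [H.lim_two.eventually (lt_mem_nhds H.pos_two)] with K h0
    have e1 : Tendsto (fun n : ℕ => (K : ℝ) ^ 2 * M₂ n / n) atTop (𝓝 0) :=
      (H.two.const_mul ((K : ℝ) ^ 2)).div_atTop tendsto_natCast_atTop_atTop
    filter_upwards [H.size, H.two_le_size, H.two_eq, H.scale.eventually_gt_atTop 0,
      eventually_gt_atTop 0, H.cut_one_eq K, H.cut_two_eq K, hG K, H.eventually_cutoff K,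
      (H.tendsto_cut K).eventually (lt_mem_nhds h0),
      e1.eventually (gt_mem_nhds zero_lt_one)] with n hm hm2 h2 ht hn hc1 hc2 hcr hL hκ hc
    exact le_nonadjProb_scaled (P n) hn ht hm hm2 h2 (Nat.cast_nonneg K)
      (fun k => cutoff_nonneg K _) (fun k => cutoff_le_one K _) hL hc1 hc2 hκ.le hc.le hcr

theorem tendsto_nonadjProb_one (H : MomentLimits m P t M₁ M₂ z₁ z₂ G₁ G₂ g₁ g₂) :
    Tendsto (fun n : ℕ => n * nonadjProb (P n) n 1) atTop (𝓝 (z₁ ^ 2 * z₂)) := by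
  have hG : ∀ K, ∀ᶠ n in atTop,
      sizeEx (P n) (fun k => k ^ 1 * cutoff K (k / t n)) = G₁ K n * t n ^ 1 := by
    simpa using H.cut_one_eq
  have e : ((1 : ℕ).factorial : ℝ)⁻¹ * z₂ ^ 1 * z₁ ^ 2 = z₁ ^ 2 * z₂ := by
    simp [mul_comm]
  have h := H.tendsto_nonadjProb (u := fun n => M₁ n ^ 2 * M₂ n) hG H.cut_one H.lim_one
    (by rw [e]; exact (H.one.pow 2).mul H.two) (by
      filter_upwards [H.size, H.one_eq, H.two_eq, H.scale.eventually_gt_atTop 0,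
        eventually_gt_atTop 0] with n hm h1 h2 ht hn
      simpa using nonadjProb_one_le_scaled (P n) hn ht hm h1 h2)
  rw [e] at h
  simpa using h

theorem tendsto_nonadjProb_two (H : MomentLimits m P t M₁ M₂ z₁ z₂ G₁ G₂ g₁ g₂) :
    Tendsto (fun n : ℕ => n ^ 2 * nonadjProb (P n) n 2) atTop (𝓝 (z₂ ^ 4 / 2)) := by
  have e : ((2 : ℕ).factorial : ℝ)⁻¹ * z₂ ^ 2 * z₂ ^ 2 = z₂ ^ 4 / 2 := by
    rw [Nat.factorial_two]; push_cast; ring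
  have h := H.tendsto_nonadjProb (u := fun n => M₂ n ^ 4 / 2) H.cut_two_eq H.cut_two H.lim_two
    (by rw [e]; exact (H.two.pow 4).div_const 2) (by
      filter_upwards [H.size, H.two_eq, H.scale.eventually_gt_atTop 0,
        eventually_gt_atTop 0] with n hm h2 ht hn
      exact nonadjProb_two_le_scaled (P n) hn ht hm h2)
  rwa [e] at h

/-- The upper and lower bounds differ in the limit `n → ∞` by `2 z₂² (z₂ - g₂ K)`, the truncated
part of the second moment, which vanishes as `K → ∞`. -/
theorem tendsto_adjProb_two (H : MomentLimits m P t M₁ M₂ z₁ z₂ G₁ G₂ g₁ g₂) {c : ℝ}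
    (hc : Tendsto (fun n : ℕ => n / t n ^ 2) atTop (𝓝 c)) :
    Tendsto (fun n : ℕ => n ^ 2 * adjProb (P n) n 2) atTop (𝓝 (c * (z₁ ^ 4 / 2))) := by
  obtain ⟨l, hl, hle⟩ := H.exists_le_adjProb 2
  have ht2 : Tendsto (fun n => 2 * t n ^ 2) atTop atTop :=
    ((tendsto_pow_atTop two_ne_zero).comp H.scale).const_mul_atTop two_pos
  refine tendsto_of_families (l := fun _ n => n / t n ^ 2 * l n) (l' := fun _ => c * (z₁ ^ 4 / 2))
    (u := fun K n => n / t n ^ 2 * (M₁ n ^ 4 / 2) + M₁ n ^ 2 * M₂ n ^ 2 / (2 * t n ^ 2) +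
      M₁ n * M₂ n ^ 3 / t n + (K : ℝ) ^ 2 * M₂ n ^ 4 / n + 2 * M₂ n ^ 2 * (M₂ n - G₂ K n))
    (u' := fun K => c * (z₁ ^ 4 / 2) + 2 * z₂ ^ 2 * (z₂ - g₂ K))
    (Eventually.of_forall fun _ => ?_) tendsto_const_nhds (Eventually.of_forall fun _ => ?_)
    (Eventually.of_forall fun K => ?_) ?_ (Eventually.of_forall fun K => ?_)
  · have h := hc.mul hl
    refine h.trans (le_of_eq ?_)
    rw [Nat.factorial_two]
    congr 1
    push_cast
    ring
  · filter_upwards [hle, H.scale.eventually_gt_atTop 0] with n hn ht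
    calc n / t n ^ 2 * l n ≤ n / t n ^ 2 * (n * t n ^ 2 * adjProb (P n) n 2) := by gcongr
      _ = _ := by field_simp
  · have h := ((((hc.mul ((H.one.pow 4).div_const 2)).add
      (((H.one.pow 2).mul (H.two.pow 2)).div_atTop ht2)).add
      ((H.one.mul (H.two.pow 3)).div_atTop H.scale)).add
      (((H.two.pow 4).const_mul ((K : ℝ) ^ 2)).div_atTop tendsto_natCast_atTop_atTop)).add
      (((H.two.pow 2).const_mul 2).mul (H.two.sub (H.cut_two K)))
    simpa using h
  · have h := ((tendsto_const_nhds (x := z₂)).sub H.lim_two).const_mul (2 * z₂ ^ 2)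
    simpa using h.const_add (c * (z₁ ^ 4 / 2))
  · filter_upwards [H.size, H.one_eq, H.two_eq, H.scale.eventually_gt_atTop 0,
      eventually_gt_atTop 0, H.cut_two_eq K, H.eventually_cutoff K] with n hm h1 h2 ht hn hc2 hL
    exact adjProb_two_le_scaled (P n) hn ht hm h1 h2 (fun k => cutoff_le_one K _) hL hc2

theorem tendsto_common_zero (H : MomentLimits m P t M₁ M₂ z₁ z₂ G₁ G₂ g₁ g₂) :
    Tendsto (fun n : ℕ => adjProb (P n) n 0 + nonadjProb (P n) n 0) atTop (𝓝 1) := by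
  have hb : Tendsto (fun n : ℕ => adjBound (P n) n) atTop (𝓝 0) := by
    have h := H.tendsto_adjBound.div_atTop tendsto_natCast_atTop_atTop
    refine h.congr' ?_
    filter_upwards [eventually_ne_atTop 0] with n hn
    have : (n : ℝ) ≠ 0 := by exact_mod_cast hn
    field_simp
  have hl : Tendsto (fun n => 1 - adjBound (P n) n - M₁ n ^ 2 * M₂ n / n) atTop (𝓝 1) := by
    simpa using (hb.const_sub 1).sub
      (((H.one.pow 2).mul H.two).div_atTop tendsto_natCast_atTop_atTop)
  refine tendsto_of_tendsto_of_tendsto_of_le_of_le' hl tendsto_const_nhds ?_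
    (Eventually.of_forall fun n => adjProb_add_nonadjProb_le_one (P n) n 0)
  filter_upwards [H.size, H.one_eq, H.two_eq, H.scale.eventually_gt_atTop 0,
    eventually_gt_atTop 0] with n hm h1 h2 ht hn
  exact le_common_zero_scaled (P n) hn ht hm h1 h2

theorem tendsto_adjProb_zero (H : MomentLimits m P t M₁ M₂ z₁ z₂ G₁ G₂ g₁ g₂) :
    Tendsto (fun n : ℕ => n * adjProb (P n) n 0) atTop (𝓝 (z₁ ^ 2)) := by
  obtain ⟨l, hl, hle⟩ := H.exists_le_adjProb 0
  refine tendsto_of_tendsto_of_tendsto_of_le_of_le' (by simpa using hl) H.tendsto_edge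
    (by simpa using hle) (Eventually.of_forall fun n =>
      mul_le_mul_of_nonneg_left (adjProb_le_edge (P n) n 0) (Nat.cast_nonneg n))

theorem tendsto_cl_zero (H : MomentLimits m P t M₁ M₂ z₁ z₂ G₁ G₂ g₁ g₂) :
    Tendsto (fun n : ℕ => n * cl n (P n) 0) atTop (𝓝 (z₁ ^ 2)) := by
  have h := H.tendsto_adjProb_zero.div H.tendsto_common_zero one_ne_zero
  rw [div_one] at h
  refine h.congr' ?_
  filter_upwards [eventually_ge_atTop 2] with n hn
  rw [Pi.div_apply, cl_eq (P n) hn, mul_div_assoc]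

theorem cl_zero (H : MomentLimits m P t M₁ M₂ z₁ z₂ G₁ G₂ g₁ g₂) :
    ∃ ε : ℕ → ℝ, Tendsto ε atTop (𝓝 0) ∧
      ∀ᶠ n in atTop, cl n (P n) 0 = edgeProb n (P n) * (1 + ε n) := by
  have hz : z₁ ^ 2 ≠ 0 := (pow_pos H.pos_one 2).ne'
  refine ⟨fun n => (n * cl n (P n) 0) /
    (n * pairEx (P n) (fun A B => if ¬Disjoint A B then 1 else 0)) - 1, ?_, ?_⟩
  · have h := (H.tendsto_cl_zero.div H.tendsto_edge hz).sub_const 1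
    rwa [div_self hz, sub_self] at h
  · filter_upwards [eventually_ge_atTop 2, H.tendsto_edge.eventually_ne hz] with n hn h0
    have hn' : (n : ℝ) ≠ 0 := left_ne_zero_of_mul h0
    have he := right_ne_zero_of_mul h0
    rw [edgeProb_eq (P n) hn, add_sub_cancel, mul_div_mul_left _ _ hn', mul_div_cancel₀ _ he]

theorem cl_zero_isBigO (H : MomentLimits m P t M₁ M₂ z₁ z₂ G₁ G₂ g₁ g₂) :
    (fun n => cl n (P n) 0) =O[atTop] (fun n => ((n : ℝ))⁻¹) := by
  have h := (H.tendsto_cl_zero.isBigO_one ℝ).mul (isBigO_refl (fun n : ℕ => (n : ℝ)⁻¹) atTop)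
  refine (h.congr' ?_ ?_)
  · filter_upwards [eventually_ne_atTop 0] with n hn
    have : (n : ℝ) ≠ 0 := by exact_mod_cast hn
    field_simp
  · exact Eventually.of_forall fun n => one_mul _

theorem tendsto_common_one (H : MomentLimits m P t M₁ M₂ z₁ z₂ G₁ G₂ g₁ g₂) :
    Tendsto (fun n : ℕ => n * (adjProb (P n) n 1 + nonadjProb (P n) n 1)) atTop
      (𝓝 (z₁ ^ 2 * z₂)) := by
  simpa [mul_add] using H.tendsto_adjProb_one.add H.tendsto_nonadjProb_one

theorem tendsto_cl_one (H : MomentLimits m P t M₁ M₂ z₁ z₂ G₁ G₂ g₁ g₂) :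
    Tendsto (fun n => cl n (P n) 1) atTop (𝓝 0) := by
  have hz : z₁ ^ 2 * z₂ ≠ 0 := (mul_pos (pow_pos H.pos_one 2) H.pos_two).ne'
  have h := H.tendsto_adjProb_one.div H.tendsto_common_one hz
  rw [zero_div] at h
  refine h.congr' ?_
  filter_upwards [eventually_ge_atTop 2] with n hn
  have hn' : (n : ℝ) ≠ 0 := by exact_mod_cast (by omega : n ≠ 0)
  rw [Pi.div_apply, cl_eq (P n) hn, mul_div_mul_left _ _ hn']

/-- The bounds on `n * adjProb` for `r = 1` are `z₁³ (1 + o(1)) / t` from below and `M₁³ / t + M₂³ /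
n` from above. As `β` may grow arbitrarily fast, `1 / n` need not be negligible against `1 / t`,
hence the two error terms. -/
theorem cl_one (H : MomentLimits m P t M₁ M₂ z₁ z₂ G₁ G₂ g₁ g₂) :
    ∃ ε η : ℕ → ℝ, Tendsto ε atTop (𝓝 0) ∧ η =O[atTop] (fun n => ((n : ℝ))⁻¹) ∧
      ∀ᶠ n in atTop, cl n (P n) 1 = (t n)⁻¹ * (z₁ / z₂) * (1 + ε n) + η n := by
  have hz1 := H.pos_one
  have hz2 := H.pos_two
  have hz : z₁ ^ 2 * z₂ ≠ 0 := by positivity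
  obtain ⟨l, hl, hle⟩ := H.exists_le_adjProb 1
  let c : ℕ → ℝ := fun n => n * (adjProb (P n) n 1 + nonadjProb (P n) n 1)
  let v : ℕ → ℝ := fun n => (t n)⁻¹ * (z₁ / z₂)
  let u : ℕ → ℝ := fun n => M₁ n ^ 3 / c n * (z₂ / z₁)
  have hc : Tendsto c atTop (𝓝 (z₁ ^ 2 * z₂)) := H.tendsto_common_one
  have hcpos : ∀ᶠ n in atTop, 0 < c n := hc.eventually (lt_mem_nhds (by positivity))
  have hu : Tendsto u atTop (𝓝 1) := by
    have h := ((H.one.pow 3).div hc hz).mul_const (z₂ / z₁)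
    refine h.trans (le_of_eq ?_)
    congr 1
    field_simp
  have hlow : Tendsto (fun n => l n / c n * (z₂ / z₁)) atTop (𝓝 1) := by
    have h := (hl.div hc hz).mul_const (z₂ / z₁)
    refine h.trans (le_of_eq ?_)
    congr 1
    rw [Nat.factorial_one, Nat.cast_one]
    field_simp
  have hv : ∀ᶠ n in atTop, 0 < v n := by
    filter_upwards [H.scale.eventually_gt_atTop 0] with n ht
    positivity
  have hcl : ∀ᶠ n : ℕ in atTop, cl n (P n) 1 = n * adjProb (P n) n 1 / c n := by
    filter_upwards [eventually_ge_atTop 2] with n hn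
    have hn' : (n : ℝ) ≠ 0 := by exact_mod_cast (by omega : n ≠ 0)
    rw [cl_eq (P n) hn, mul_div_mul_left _ _ hn']
  -- Cap the ratio of `cl(1)` to its main term `v` at `u`, which tends to one. The capped ratio
  -- supplies `1 + ε`; the excess above the cap is at most `M₂³ / (c n)` and becomes `η`.
  let w : ℕ → ℝ := fun n => min (cl n (P n) 1 / v n) (u n)
  have hw : Tendsto w atTop (𝓝 1) := by
    have hlo : Tendsto (fun n => min (l n / c n * (z₂ / z₁)) (u n)) atTop (𝓝 1) := by
      simpa using hlow.min hu
    refine tendsto_of_tendsto_of_tendsto_of_le_of_le' hlo hu ?_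
      (Eventually.of_forall fun n => min_le_right _ _)
    filter_upwards [hcpos, hcl, hle, H.scale.eventually_gt_atTop 0] with n h1 h2 h3 ht
    refine min_le_min_right _ ?_
    rw [h2]
    calc l n / c n * (z₂ / z₁) ≤ n * t n ^ 1 * adjProb (P n) n 1 / c n * (z₂ / z₁) := by gcongr
      _ = _ := by simp only [v]; field_simp
  refine ⟨fun n => w n - 1, fun n => cl n (P n) 1 - v n * w n, ?_, ?_, ?_⟩
  · simpa using hw.sub_const 1
  · have hb : (fun n : ℕ => M₂ n ^ 3 / c n * (n : ℝ)⁻¹) =O[atTop] (fun n : ℕ => (n : ℝ)⁻¹) := by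
      have h := (((H.two.pow 3).div hc hz).isBigO_one ℝ).mul
        (isBigO_refl (fun n : ℕ => (n : ℝ)⁻¹) atTop)
      simp only [one_mul] at h
      exact h
    refine IsBigO.trans (IsBigO.of_norm_eventuallyLE ?_) hb
    filter_upwards [hcpos, hcl, hv, H.adjProb_one_upper, H.scale.eventually_gt_atTop 0,
      H.two.eventually (lt_mem_nhds hz2)] with n h1 h2 h3 h4 ht hM
    have h5 : 0 ≤ cl n (P n) 1 - v n * w n := by
      rw [sub_nonneg, mul_comm, ← le_div_iff₀ h3]
      exact min_le_left _ _
    rw [Real.norm_of_nonneg h5]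
    have h6 : 0 ≤ M₂ n ^ 3 / c n * (n : ℝ)⁻¹ := by positivity
    rcases min_choice (cl n (P n) 1 / v n) (u n) with h | h
    · simp only [w, h]
      rw [mul_div_cancel₀ _ h3.ne', sub_self]
      exact h6
    · simp only [w, h]
      rw [h2, sub_le_iff_le_add]
      refine (div_le_div_of_nonneg_right h4 h1.le).trans (le_of_eq ?_)
      simp only [u, v]
      field_simp
      ring
  · refine Eventually.of_forall fun n => ?_
    simp only [v]
    ring

theorem tendsto_cl_two (H : MomentLimits m P t M₁ M₂ z₁ z₂ G₁ G₂ g₁ g₂) {c : ℝ}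
    (hc : Tendsto (fun n : ℕ => n / t n ^ 2) atTop (𝓝 c)) (hc0 : 0 ≤ c) :
    Tendsto (fun n => cl n (P n) 2) atTop
      (𝓝 (c * (z₁ ^ 4 / 2) / (c * (z₁ ^ 4 / 2) + z₂ ^ 4 / 2))) := by
  have hz1 := H.pos_one
  have hz2 := H.pos_two
  have h := (H.tendsto_adjProb_two hc).div
    ((H.tendsto_adjProb_two hc).add H.tendsto_nonadjProb_two) (by positivity)
  refine h.congr' ?_
  filter_upwards [eventually_ge_atTop 2] with n hn
  have hn' : (n : ℝ) ^ 2 ≠ 0 := by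
    have : (n : ℝ) ≠ 0 := by exact_mod_cast (by omega : n ≠ 0)
    positivity
  rw [Pi.div_apply, cl_eq (P n) hn, ← mul_add, mul_div_mul_left _ _ hn']

/-- No upper bound on `adjProb` is needed: it is at least of order `1 / (n t^r)`, while `nonadjProb`
is at most of order `1 / n²`. -/
theorem cl_tendsto_one (H : MomentLimits m P t M₁ M₂ z₁ z₂ G₁ G₂ g₁ g₂) {r : ℕ} (hr : 2 ≤ r)
    (ht : Tendsto (fun n : ℕ => t n ^ r / n) atTop (𝓝 0)) :
    (∀ᶠ n in atTop, 0 < (jointLaw n (P n)).real (commonEvent n (m n) r)) ∧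
      Tendsto (fun n => cl n (P n) r) atTop (𝓝 1) := by
  obtain ⟨l, hl, hle⟩ := H.exists_le_adjProb r
  have hz1 := H.pos_one
  have hv : Tendsto (fun n : ℕ => t n ^ r / n * M₂ n ^ 4) atTop (𝓝 0) := by
    simpa using ht.mul (H.two.pow 4)
  have h := tendsto_ratio_one (a := fun n => adjProb (P n) n r)
    (e := fun n => nonadjProb (P n) n r) (s := fun n => n * t n ^ r) (by positivity) (by
      filter_upwards [H.scale.eventually_gt_atTop 0, eventually_gt_atTop 0] with n ht hn
      have : (0 : ℝ) < n := by exact_mod_cast hn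
      positivity) (fun n => nonadjProb_nonneg (P n) n r) hl hle hv (by
      filter_upwards [H.size, H.two_eq, H.scale.eventually_gt_atTop 0,
        eventually_gt_atTop 0] with n hm h2 ht hn
      exact nonadjProb_le_scaled (P n) hn ht hm h2 hr)
  refine ⟨?_, h.2.congr' ?_⟩
  · filter_upwards [h.1, eventually_ge_atTop 2] with n h1 hn
    rwa [jointLaw_real_common (P n) hn]
  · filter_upwards [eventually_ge_atTop 2] with n hn
    rw [cl_eq (P n) hn]

/-- For `r = 1, 2` the positive limit of the rescaled probability gives positivity without any
restriction on the growth of `β`; for `r = 2` disjoint pairs already suffice. -/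
theorem common_pos (H : MomentLimits m P t M₁ M₂ z₁ z₂ G₁ G₂ g₁ g₂) {r : ℕ} (hr : r ≤ 2) :
    ∀ᶠ n in atTop, 0 < (jointLaw n (P n)).real (commonEvent n (m n) r) := by
  have hz1 := H.pos_one
  have hz2 := H.pos_two
  interval_cases r
  · filter_upwards [eventually_ge_atTop 2,
      H.tendsto_common_zero.eventually (lt_mem_nhds zero_lt_one)] with n hn h
    rwa [jointLaw_real_common (P n) hn]
  · filter_upwards [eventually_ge_atTop 2,
      H.tendsto_common_one.eventually (lt_mem_nhds (by positivity))] with n hn h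
    rw [jointLaw_real_common (P n) hn]
    exact pos_of_mul_pos_right h (Nat.cast_nonneg n)
  · filter_upwards [eventually_ge_atTop 2,
      H.tendsto_nonadjProb_two.eventually (lt_mem_nhds (by positivity))] with n hn h
    rw [jointLaw_real_common (P n) hn]
    exact add_pos_of_nonneg_of_pos (adjProb_nonneg _ _ _) (pos_of_mul_pos_right h (by positivity))

end MomentLimits

/-! ### Poisson moments and the moments of the asymptotic degree -/

theorem hasSum_exp_neg_mul_pow_div_factorial (x : ℝ) :
    HasSum (fun k : ℕ => Real.exp (-x) * x ^ k / k.factorial) 1 := by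
  have h := (NormedSpace.expSeries_div_hasSum_exp x).mul_left (Real.exp (-x))
  rw [← Real.exp_eq_exp_ℝ, ← Real.exp_add, neg_add_cancel, Real.exp_zero] at h
  simpa only [mul_div_assoc] using h

theorem hasSum_mul_exp_neg_mul_pow_div_factorial (x : ℝ) :
    HasSum (fun k : ℕ => (k : ℝ) * (Real.exp (-x) * x ^ k / k.factorial)) x := by
  have h := (hasSum_exp_neg_mul_pow_div_factorial x).mul_left x
  have h' := (hasSum_nat_add_iff (f := fun k : ℕ => (k : ℝ) * (Real.exp (-x) * x ^ k / k.factorial))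
    (g := x * 1) 1).1 (by
      refine h.congr_fun fun k => ?_
      rw [Nat.factorial_succ]
      push_cast
      have : (k.factorial : ℝ) ≠ 0 := by exact_mod_cast k.factorial_ne_zero
      field_simp
      ring)
  simpa using h'

theorem hasSum_sq_mul_exp_neg_mul_pow_div_factorial (x : ℝ) :
    HasSum (fun k : ℕ => (k : ℝ) ^ 2 * (Real.exp (-x) * x ^ k / k.factorial)) (x ^ 2 + x) := by
  have h := ((hasSum_mul_exp_neg_mul_pow_div_factorial x).add
    (hasSum_exp_neg_mul_pow_div_factorial x)).mul_left x
  have h' := (hasSum_nat_add_iff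
    (f := fun k : ℕ => (k : ℝ) ^ 2 * (Real.exp (-x) * x ^ k / k.factorial)) (g := x * (x + 1)) 1).1
    (by
      refine h.congr_fun fun k => ?_
      rw [Nat.factorial_succ]
      push_cast
      have : (k.factorial : ℝ) ≠ 0 := by exact_mod_cast k.factorial_ne_zero
      field_simp
      ring)
  rw [Finset.sum_range_one, Nat.cast_zero, zero_pow two_ne_zero, zero_mul, add_zero] at h'
  rwa [sq, ← mul_add_one]

section

variable {Ω : Type*} [MeasurableSpace Ω] {μ : Measure Ω} {Z : Ω → ℝ}

/-- Sum and integral are exchanged. The terms are nonnegative almost everywhere, so they serve as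
their own dominating functions, with integrable sum `f`. -/
theorem degreeMoment_eq_integral (hZ : AEMeasurable Z μ) (hZ0 : ∀ᵐ ω ∂μ, 0 ≤ Z ω)
    (hz : 0 ≤ zMoment μ Z 1) {r : ℕ} {f : ℝ → ℝ}
    (hint : Integrable (fun ω => f (zMoment μ Z 1 * Z ω)) μ)
    (hf : ∀ x : ℝ,
      HasSum (fun k : ℕ => (k : ℝ) ^ r * (Real.exp (-x) * x ^ k / k.factorial)) (f x)) :
    degreeMoment μ Z r = ∫ ω, f (zMoment μ Z 1 * Z ω) ∂μ := by
  set z := zMoment μ Z 1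
  let F : ℕ → Ω → ℝ := fun k ω =>
    (k : ℝ) ^ r * (Real.exp (-(z * Z ω)) * (z * Z ω) ^ k / k.factorial)
  have h := hasSum_integral_of_dominated_convergence (μ := μ) (F := F)
    (f := fun ω => f (z * Z ω)) F (fun k => by
      refine AEMeasurable.aestronglyMeasurable ?_
      simp only [F]
      fun_prop) (fun k => by
      filter_upwards [hZ0] with ω hω
      have : 0 ≤ z * Z ω := mul_nonneg hz hω
      rw [Real.norm_of_nonneg]
      positivity)
    (Eventually.of_forall fun ω => (hf (z * Z ω)).summable)
    (hint.congr (Eventually.of_forall fun ω => ((hf (z * Z ω)).tsum_eq).symm))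
    (Eventually.of_forall fun ω => hf (z * Z ω))
  rw [degreeMoment, ← h.tsum_eq]
  refine tsum_congr fun k => ?_
  rw [degreeProb, ← integral_const_mul]

theorem degreeMoment_one (hZ : AEMeasurable Z μ) (hZ0 : ∀ᵐ ω ∂μ, 0 ≤ Z ω)
    (hz : 0 ≤ zMoment μ Z 1) (h1 : Integrable Z μ) :
    degreeMoment μ Z 1 = zMoment μ Z 1 ^ 2 := by
  rw [degreeMoment_eq_integral hZ hZ0 hz (f := fun x => x) (h1.const_mul _) (fun x => by
    simpa using hasSum_mul_exp_neg_mul_pow_div_factorial x), integral_const_mul]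
  simp [zMoment, sq]

theorem degreeMoment_two (hZ : AEMeasurable Z μ) (hZ0 : ∀ᵐ ω ∂μ, 0 ≤ Z ω)
    (hz : 0 ≤ zMoment μ Z 1) (h1 : Integrable Z μ) (h2 : Integrable (fun ω => Z ω ^ 2) μ) :
    degreeMoment μ Z 2 = zMoment μ Z 1 ^ 2 * zMoment μ Z 2 + zMoment μ Z 1 ^ 2 := by
  have hi2 : Integrable (fun ω => (zMoment μ Z 1 * Z ω) ^ 2) μ := by
    simp only [mul_pow]
    exact h2.const_mul _
  rw [degreeMoment_eq_integral hZ hZ0 hz (f := fun x => x ^ 2 + x) (hi2.add (h1.const_mul _))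
    hasSum_sq_mul_exp_neg_mul_pow_div_factorial, integral_add hi2 (h1.const_mul _),
    integral_const_mul]
  simp only [mul_pow]
  rw [integral_const_mul]
  simp [zMoment, sq]

theorem zMoment_two_pos (h2 : Integrable (fun ω => Z ω ^ 2) μ) (hz : 0 < zMoment μ Z 1) :
    0 < zMoment μ Z 2 := by
  refine lt_of_le_of_ne (integral_nonneg fun ω => sq_nonneg _) fun h0 => hz.ne' ?_
  have h := (integral_eq_zero_iff_of_nonneg (fun ω => sq_nonneg (Z ω)) h2).1 h0.symm
  rw [zMoment, integral_eq_zero_of_ae]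
  filter_upwards [h] with ω hω
  simpa using hω

end

/-! ### From convergence in distribution to convergence of moments -/

theorem continuous_cutoff (K : ℕ) : Continuous (cutoff K) := by
  unfold cutoff; fun_prop

theorem abs_pow_mul_cutoff_le (K r : ℕ) (y : ℝ) : |y ^ r * cutoff K y| ≤ (K : ℝ) ^ r := by
  by_cases h : cutoff K y = 0
  · simp [h]
  · rw [abs_mul, abs_pow, abs_of_nonneg (cutoff_nonneg K y)]
    calc |y| ^ r * cutoff K y ≤ |y| ^ r * 1 := by gcongr; exact cutoff_le_one K y
      _ = |y| ^ r := mul_one _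
      _ ≤ _ := by gcongr; exact abs_le_of_cutoff_ne_zero h

theorem tendsto_cutoff (y : ℝ) : Tendsto (fun K => cutoff K y) atTop (𝓝 1) := by
  refine tendsto_const_nhds.congr' ?_
  filter_upwards [tendsto_natCast_atTop_atTop.eventually_ge_atTop (1 + |y|)] with K hK
  rw [cutoff, min_eq_left (by linarith), max_eq_right zero_le_one]

/-- The left side vanishes if `|y| ≤ K - 1`; otherwise `K < |y| + 1`, and `K |y| ≤ y² + |y| ≤ 1 + 2
y²`. It bounds the tail of the first moment by the second moment divided by `K`. -/
theorem mul_abs_mul_one_sub_cutoff_le (K : ℕ) (y : ℝ) :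
    K * (|y| * (1 - cutoff K y)) ≤ 1 + 2 * y ^ 2 := by
  have hc0 := cutoff_nonneg K y
  have hc1 := cutoff_le_one K y
  have hy := abs_nonneg y
  rw [← sq_abs y]
  rcases le_or_gt (|y| + 1) K with h | h
  · have : cutoff K y = 1 := by
      rw [cutoff, min_eq_left (by linarith), max_eq_right zero_le_one]
    rw [this, sub_self, mul_zero, mul_zero]
    positivity
  · have h1 : |y| * (1 - cutoff K y) ≤ |y| := mul_le_of_le_one_right hy (by linarith)
    have h2 : (K : ℝ) * (|y| * (1 - cutoff K y)) ≤ K * |y| :=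
      mul_le_mul_of_nonneg_left h1 (Nat.cast_nonneg K)
    nlinarith [sq_nonneg (|y| - 1)]

section

variable {Ω : Type*} [MeasurableSpace Ω] {μ : Measure Ω} [IsProbabilityMeasure μ] {Z : Ω → ℝ}
  {m : ℕ → ℕ} {P : (n : ℕ) → PMF (Fin (m n + 1))}

theorem tendsto_integral_scaledSize
    (h_dist : TendstoInDistribution (fun n => scaledSize n (m n)) atTop Z
      (fun n => (P n).toMeasure) μ) {f : ℝ → ℝ} (hf : Continuous f) {C : ℝ} (hC : ∀ y, |f y| ≤ C) :
    Tendsto (fun n => sizeEx (P n) fun k => f (k * √((n : ℝ) / m n))) atTop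
      (𝓝 (∫ ω, f (Z ω) ∂μ)) := by
  have h := (ProbabilityMeasure.tendsto_iff_forall_integral_tendsto.1 h_dist.tendsto)
    (BoundedContinuousFunction.ofNormedAddCommGroup f hf C hC)
  simp only [ProbabilityMeasure.coe_mk, BoundedContinuousFunction.coe_ofNormedAddCommGroup] at h
  rw [integral_map h_dist.aemeasurable_limit hf.aestronglyMeasurable] at h
  refine h.congr fun n => ?_
  rw [integral_map (h_dist.forall_aemeasurable n) hf.aestronglyMeasurable, PMF.integral_eq_sum]
  simp [sizeEx, scaledSize]

/-- Test the convergence with a bounded continuous function that is positive exactly on the negative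
half-line; it vanishes at all sizes. -/
theorem ae_nonneg_of_tendstoInDistribution
    (h_dist : TendstoInDistribution (fun n => scaledSize n (m n)) atTop Z
      (fun n => (P n).toMeasure) μ) : ∀ᵐ ω ∂μ, 0 ≤ Z ω := by
  let f : ℝ → ℝ := fun y => min 1 (max 0 (-y))
  have hf : Continuous f := by fun_prop
  have hf0 : ∀ y, 0 ≤ f y := fun y => le_min zero_le_one (le_max_left _ _)
  have hC : ∀ y, |f y| ≤ 1 := fun y => by
    rw [abs_of_nonneg (hf0 y)]; exact min_le_left _ _
  have h := tendsto_integral_scaledSize h_dist hf hC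
  have h0 : ∀ n, (sizeEx (P n) fun k => f (k * √((n : ℝ) / m n))) = 0 := by
    intro n
    refine Finset.sum_eq_zero fun k _ => ?_
    have : (0 : ℝ) ≤ (k : ℕ) * √((n : ℝ) / m n) := by positivity
    simp only [f]
    rw [max_eq_left (by linarith), min_eq_right zero_le_one, mul_zero]
  simp only [h0] at h
  have hI := tendsto_nhds_unique h tendsto_const_nhds
  have hint : Integrable (fun ω => f (Z ω)) μ :=
    Integrable.of_bound
      (hf.comp_aestronglyMeasurable h_dist.aemeasurable_limit.aestronglyMeasurable)
      1 (Eventually.of_forall fun ω => hC _)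
  have hae := (integral_eq_zero_iff_of_nonneg (fun ω => hf0 (Z ω)) hint).1 hI
  filter_upwards [hae] with ω hω
  by_contra! hneg
  have : 0 < f (Z ω) := lt_min zero_lt_one (lt_max_of_lt_right (by linarith))
  exact this.ne' hω

theorem sizeEx_add {m : ℕ} (P : PMF (Fin (m + 1))) (f g : ℕ → ℝ) :
    sizeEx P (fun k => f k + g k) = sizeEx P f + sizeEx P g := by
  simp only [sizeEx, mul_add, Finset.sum_add_distrib]

theorem sizeEx_one {m : ℕ} (P : PMF (Fin (m + 1))) : sizeEx P (fun _ => 1) = 1 := by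
  have h : ∑ k : Fin (m + 1), P k = 1 :=
    (tsum_fintype (L := .unconditional _) P).symm.trans P.tsum_coe
  simp only [sizeEx, mul_one]
  rw [← ENNReal.toReal_sum fun k _ => P.apply_ne_top k, h, ENNReal.toReal_one]

theorem sizeEx_div_scale {m : ℕ} (P : PMF (Fin (m + 1))) (r : ℕ) (g : ℕ → ℝ) (n : ℕ) :
    sizeEx P (fun k => (k * √((n : ℝ) / m)) ^ r * g k) =
      sizeEx P (fun k => k ^ r * g k) / √((m : ℝ) / n) ^ r := by
  rw [div_eq_inv_mul (sizeEx P _), ← sizeEx_const_mul]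
  congr 1
  ext k
  rw [← inv_div (m : ℝ) n, Real.sqrt_inv, mul_pow, inv_pow]
  ring

theorem momentLimits (β : ℕ → ℝ) (hβ_def : ∀ n, β n = (m n : ℝ) / n)
    (h_dist : TendstoInDistribution (fun n => scaledSize n (m n)) atTop Z
      (fun n => (P n).toMeasure) μ)
    (h_int : Integrable (fun ω => Z ω ^ 2) μ)
    (h_mom : Tendsto (fun n => ∫ x, scaledSize n (m n) x ^ 2 ∂(P n).toMeasure) atTop
      (𝓝 (zMoment μ Z 2)))
    (hZ_pos : 0 < zMoment μ Z 1) (hβ : Tendsto β atTop atTop) :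
    MomentLimits m P (fun n => √(β n)) (fun n => sizeEx (P n) (fun k => k) / √(β n))
      (fun n => sizeEx (P n) (fun k => k ^ 2) / √(β n) ^ 2) (zMoment μ Z 1) (zMoment μ Z 2)
      (fun K n => sizeEx (P n) (fun k => k * cutoff K (k / √(β n))) / √(β n))
      (fun K n => sizeEx (P n) (fun k => k ^ 2 * cutoff K (k / √(β n))) / √(β n) ^ 2)
      (fun K => ∫ ω, Z ω * cutoff K (Z ω) ∂μ) (fun K => ∫ ω, Z ω ^ 2 * cutoff K (Z ω) ∂μ) := by
  have hscale : Tendsto (fun n => √(β n)) atTop atTop := Real.tendsto_sqrt_atTop.comp hβ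
  have hne : ∀ᶠ n in atTop, √(β n) ≠ 0 := by
    filter_upwards [hscale.eventually_gt_atTop 0] with n hn using hn.ne'
  have hZm := h_dist.aemeasurable_limit
  have hmem : MemLp Z 2 μ := (memLp_two_iff_integrable_sq hZm.aestronglyMeasurable).2 h_int
  have hZint : Integrable Z μ := hmem.integrable (by norm_num)
  have hcutm : ∀ (K r : ℕ), AEStronglyMeasurable (fun ω => Z ω ^ r * cutoff K (Z ω)) μ :=
    fun K r => ((continuous_pow r).mul (continuous_cutoff K)).comp_aestronglyMeasurable
      hZm.aestronglyMeasurable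
  have hcut : ∀ K r : ℕ, Tendsto
      (fun n => sizeEx (P n) (fun k => k ^ r * cutoff K (k / √(β n))) / √(β n) ^ r) atTop
      (𝓝 (∫ ω, Z ω ^ r * cutoff K (Z ω) ∂μ)) := by
    intro K r
    have h := tendsto_integral_scaledSize h_dist ((continuous_pow r).mul (continuous_cutoff K))
      (abs_pow_mul_cutoff_le K r)
    refine h.congr fun n => ?_
    rw [hβ_def, ← sizeEx_div_scale (P n) r (fun k => cutoff K (k / √((m n : ℝ) / n))) n]
    congr 1
    ext k
    rw [← inv_div (m n : ℝ) n, Real.sqrt_inv, ← div_eq_mul_inv, Pi.mul_apply]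
  have hlim : ∀ r : ℕ, Integrable (fun ω => Z ω ^ r) μ →
      Tendsto (fun K => ∫ ω, Z ω ^ r * cutoff K (Z ω) ∂μ) atTop (𝓝 (∫ ω, Z ω ^ r ∂μ)) := by
    intro r hr
    refine tendsto_integral_of_dominated_convergence (fun ω => ‖Z ω ^ r‖) (fun K => hcutm K r)
      hr.norm (fun K => Eventually.of_forall fun ω => ?_) (Eventually.of_forall fun ω => ?_)
    · rw [norm_mul, Real.norm_of_nonneg (cutoff_nonneg K _)]
      exact mul_le_of_le_one_right (norm_nonneg _) (cutoff_le_one K _)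
    · simpa using (tendsto_cutoff (Z ω)).const_mul (Z ω ^ r)
  have htwo : Tendsto (fun n => sizeEx (P n) (fun k => k ^ 2) / √(β n) ^ 2) atTop
      (𝓝 (zMoment μ Z 2)) := by
    refine h_mom.congr fun n => ?_
    rw [PMF.integral_eq_sum, hβ_def]
    have h := sizeEx_div_scale (P n) 2 (fun _ => 1) n
    simp only [mul_one] at h
    rw [← h]
    simp [sizeEx, scaledSize]
  have hcut1 : ∀ K : ℕ, Tendsto
      (fun n => sizeEx (P n) (fun k => k * cutoff K (k / √(β n))) / √(β n)) atTop
      (𝓝 (∫ ω, Z ω * cutoff K (Z ω) ∂μ)) := fun K => by simpa using hcut K 1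
  have hlim1 : Tendsto (fun K => ∫ ω, Z ω * cutoff K (Z ω) ∂μ) atTop (𝓝 (zMoment μ Z 1)) := by
    simpa [zMoment] using hlim 1 (by simpa using hZint)
  -- Convergence of the first moment is not assumed. Second moments are bounded, so truncating the
  -- first moment costs `O(1 / K)` uniformly in large `n`, and the truncated moments converge.
  have hbound : ∀ K : ℕ, 0 < K → ∀ᶠ n in atTop,
      |sizeEx (P n) (fun k => k) / √(β n) -
        sizeEx (P n) (fun k => k * cutoff K (k / √(β n))) / √(β n)| ≤
      (1 + 2 * (sizeEx (P n) (fun k => k ^ 2) / √(β n) ^ 2)) / K := by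
    intro K hK
    have hK' : (0 : ℝ) < K := by exact_mod_cast hK
    filter_upwards [hscale.eventually_gt_atTop 0] with n hn
    have e : ∀ k : ℕ, (k : ℝ) - k * cutoff K (k / √(β n)) =
        √(β n) * (|k / √(β n)| * (1 - cutoff K (k / √(β n)))) := by
      intro k
      rw [abs_of_nonneg (by positivity)]
      field_simp
    have e2 : sizeEx (P n) (fun k => k) / √(β n) -
        sizeEx (P n) (fun k => k * cutoff K (k / √(β n))) / √(β n) =
        sizeEx (P n) (fun k => |k / √(β n)| * (1 - cutoff K (k / √(β n)))) := by
      rw [← sub_div, ← sizeEx_sub]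
      simp only [e]
      rw [sizeEx_const_mul, mul_div_cancel_left₀ _ hn.ne']
    rw [e2, abs_of_nonneg (sizeEx_nonneg _ fun k => mul_nonneg (abs_nonneg _)
      (sub_nonneg.2 (cutoff_le_one _ _))), le_div_iff₀ hK', mul_comm, ← sizeEx_const_mul]
    refine (sizeEx_mono _ fun k _ => mul_abs_mul_one_sub_cutoff_le K _).trans (le_of_eq ?_)
    simp only [div_pow, div_eq_inv_mul _ (√(β n) ^ 2)]
    rw [sizeEx_add, sizeEx_one, sizeEx_const_mul, sizeEx_const_mul]
  have hsmall : Tendsto (fun K : ℕ => (1 + 2 * zMoment μ Z 2) / K) atTop (𝓝 0) :=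
    tendsto_const_div_atTop_nhds_zero_nat _
  have herr : ∀ K : ℕ, Tendsto
      (fun n => (1 + 2 * (sizeEx (P n) (fun k => k ^ 2) / √(β n) ^ 2)) / K) atTop
      (𝓝 ((1 + 2 * zMoment μ Z 2) / K)) := fun K =>
    ((htwo.const_mul 2).const_add 1).div_const _
  have hone : Tendsto (fun n => sizeEx (P n) (fun k => k) / √(β n)) atTop (𝓝 (zMoment μ Z 1)) := by
    refine tendsto_of_families (Eventually.of_forall fun K => (hcut1 K).sub (herr K))
      (by simpa using hlim1.sub hsmall) ?_
      (Eventually.of_forall fun K => (hcut1 K).add (herr K)) (by simpa using hlim1.add hsmall) ?_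
    · filter_upwards [eventually_gt_atTop 0] with K hK
      filter_upwards [hbound K hK] with n hn
      linarith [(abs_le.1 hn).1]
    · filter_upwards [eventually_gt_atTop 0] with K hK
      filter_upwards [hbound K hK] with n hn
      linarith [(abs_le.1 hn).2]
  exact
    { scale := hscale
      size := by
        filter_upwards [hβ.eventually_ge_atTop 0, eventually_ne_atTop 0] with n h1 hn
        have : (n : ℝ) ≠ 0 := by exact_mod_cast hn
        rw [Real.sq_sqrt h1, hβ_def]
        field_simp
      one_eq := hne.mono fun n hn => (div_mul_cancel₀ _ hn).symm
      two_eq := hne.mono fun n hn => (div_mul_cancel₀ _ (pow_ne_zero 2 hn)).symm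
      cut_one_eq := fun K => hne.mono fun n hn => (div_mul_cancel₀ _ hn).symm
      cut_two_eq := fun K => hne.mono fun n hn => (div_mul_cancel₀ _ (pow_ne_zero 2 hn)).symm
      one := hone
      two := htwo
      cut_one := hcut1
      cut_two := fun K => hcut K 2
      lim_one := hlim1
      lim_two := hlim 2 h_int
      pos_one := hZ_pos
      pos_two := zMoment_two_pos h_int hZ_pos }

end

end ActiveGraph

end

/-! ### The main theorem -/

theorem theorem2
    {Ω : Type*} [MeasurableSpace Ω] (μ : Measure Ω) [IsProbabilityMeasure μ] (Z : Ω → ℝ)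
    (m : ℕ → ℕ) (P : (n : ℕ) → PMF (Fin (m n + 1)))
    (β : ℕ → ℝ) (hβ_def : ∀ n, β n = (m n : ℝ) / n)
    -- convergence in distribution of the rescaled size of an attribute set to `Z`
    (h_dist : TendstoInDistribution (fun n => ActiveGraph.scaledSize n (m n)) atTop Z
      (fun n => (P n).toMeasure) μ)
    -- finiteness of the second moment of `Z` and convergence of the second moments to it
    (h_int : Integrable (fun ω => Z ω ^ 2) μ)
    (h_mom : Tendsto (fun n => ∫ x, ActiveGraph.scaledSize n (m n) x ^ 2 ∂(P n).toMeasure) atTop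
      (𝓝 (ActiveGraph.zMoment μ Z 2)))
    (hZ_pos : 0 < ActiveGraph.zMoment μ Z 1)
    (hβ : Tendsto β atTop atTop) :
    -- the conditioning events for `r = 0, 1, 2` have positive probability for all large `n`
    (∀ r ≤ 2, ∀ᶠ n in atTop,
      0 < (ActiveGraph.jointLaw n (P n)).real (ActiveGraph.commonEvent n (m n) r)) ∧
    -- `cl(0) = p_e (1 + o(1))`
    (∃ ε : ℕ → ℝ, Tendsto ε atTop (𝓝 0) ∧
      ∀ᶠ n in atTop,
        ActiveGraph.cl n (P n) 0 = ActiveGraph.edgeProb n (P n) * (1 + ε n)) ∧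
    -- `cl(1) = β_n^{-1/2} (z_1 / z_2) (1 + o(1)) + O(1/n)`
    (∃ ε η : ℕ → ℝ, Tendsto ε atTop (𝓝 0) ∧
      η =O[atTop] (fun n => ((n : ℝ))⁻¹) ∧
      ∀ᶠ n in atTop,
        ActiveGraph.cl n (P n) 1 =
          (√(β n))⁻¹ * (ActiveGraph.zMoment μ Z 1 / ActiveGraph.zMoment μ Z 2) * (1 + ε n)
            + η n) ∧
    -- in particular `cl(0) = O(1/n)` and `cl(1) = o(1)`
    ((fun n => ActiveGraph.cl n (P n) 0) =O[atTop] (fun n => ((n : ℝ))⁻¹)) ∧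
    Tendsto (fun n => ActiveGraph.cl n (P n) 1) atTop (𝓝 0) ∧
    -- the three regimes for `cl(2)`
    (Tendsto (fun n => β n / n) atTop (𝓝 0) →
      Tendsto (fun n => ActiveGraph.cl n (P n) 2) atTop (𝓝 1)) ∧
    (∀ b : ℝ, 0 < b → Tendsto (fun n => β n / n) atTop (𝓝 b) →
      Tendsto (fun n => ActiveGraph.cl n (P n) 2) atTop
        (𝓝 (1 / (1 + b *
          (ActiveGraph.degreeMoment μ Z 2 - ActiveGraph.degreeMoment μ Z 1) ^ 4 *
          (ActiveGraph.degreeMoment μ Z 1 ^ 6)⁻¹)))) ∧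
    (Tendsto (fun n => β n / n) atTop atTop →
      Tendsto (fun n => ActiveGraph.cl n (P n) 2) atTop (𝓝 0)) ∧
    -- if `β_n^k = o(n)` for every `k ≥ 1`, then `cl(r) = 1 + o(1)` for every `r ≥ 2`
    ((∀ k : ℕ, 1 ≤ k → (fun n => β n ^ k) =o[atTop] (fun n => (n : ℝ))) →
      ∀ r : ℕ, 2 ≤ r →
        (∀ᶠ n in atTop,
          0 < (ActiveGraph.jointLaw n (P n)).real (ActiveGraph.commonEvent n (m n) r)) ∧
        Tendsto (fun n => ActiveGraph.cl n (P n) r) atTop (𝓝 1)) := by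
  have H := ActiveGraph.momentLimits β hβ_def h_dist h_int h_mom hZ_pos hβ
  have hsq : ∀ᶠ n in atTop, √(β n) ^ 2 = β n := by
    filter_upwards [hβ.eventually_ge_atTop 0] with n hn using Real.sq_sqrt hn
  refine ⟨fun r hr => H.common_pos hr, H.cl_zero, H.cl_one, H.cl_zero_isBigO, H.tendsto_cl_one,
    fun h => ?_, fun b hb h => ?_, fun h => ?_, fun h r hr => ?_⟩
  · refine (H.cl_tendsto_one le_rfl (h.congr' ?_)).2
    filter_upwards [hsq] with n hn
    rw [hn]
  · have hZ := h_dist.aemeasurable_limit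
    have hZ0 := ActiveGraph.ae_nonneg_of_tendstoInDistribution h_dist
    have hZ1 : Integrable Z μ :=
      ((memLp_two_iff_integrable_sq hZ.aestronglyMeasurable).2 h_int).integrable (by norm_num)
    have hz2 := H.pos_two
    have hc : Tendsto (fun n : ℕ => (n : ℝ) / √(β n) ^ 2) atTop (𝓝 b⁻¹) := by
      refine (h.inv₀ hb.ne').congr' ?_
      filter_upwards [hsq] with n hn
      rw [hn, inv_div]
    refine (H.tendsto_cl_two hc (inv_nonneg.2 hb.le)).trans (le_of_eq ?_)
    -- Here `δ₁ = z₁²` and `δ₂ - δ₁ = z₁² z₂`, so `(δ₂ - δ₁)⁴ / δ₁⁶ = (z₂ / z₁)⁴`, and the limit of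
    -- `n / t²` is `b⁻¹`.
    rw [ActiveGraph.degreeMoment_one hZ hZ0 hZ_pos.le hZ1,
      ActiveGraph.degreeMoment_two hZ hZ0 hZ_pos.le hZ1 h_int]
    congr 1
    field_simp
    ring
  · have hc : Tendsto (fun n : ℕ => (n : ℝ) / √(β n) ^ 2) atTop (𝓝 0) := by
      refine (tendsto_inv_atTop_zero.comp h).congr' ?_
      filter_upwards [hsq] with n hn
      rw [hn, Function.comp_apply, inv_div]
    simpa using H.tendsto_cl_two hc le_rfl
  · refine H.cl_tendsto_one hr ?_
    refine squeeze_zero' (Eventually.of_forall fun n => by positivity) ?_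
      (h r (by omega)).tendsto_div_nhds_zero
    -- Once `β ≥ 1`, also `√β ≤ β`, so the hypothesis with `k = r` gives `t^r ≤ β^r = o(n)`.
    filter_upwards [hβ.eventually_ge_atTop 1] with n hn
    gcongr
    rw [Real.sqrt_le_left (by linarith)]
    nlinarith
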